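/- Let $K$ be a field of characteristic zero and let $G=(V,E)$ be a finite undirected graph (loops and multiple edges are allowed). In the algebra $B=K[x_e : e\in E]/(x_e^2 : e\in E)$ put $y_v=\sum_{e\in E} a_{v,e}x_e$ for $v\in V$, where $a_{v,e}=1$ if the edge $e$ contains the vertex $v$ (in particular if $e$ is a loop at $v$) and $a_{v,e}=0$ otherwise. Let $\mathcal C_+(G)\subseteq B$ be the $K$-subalgebra generated by the elements $y_v$, $v\in V$, and let $\mathcal C_+^k(G)$ be its component of degree $k$, with respect to the grading of $B$ in which every $x_e$ has degree $1$. Cycles have no repeated vertices; a loop is a cycle of length $1$ and two parallel edges form a cycle of length $2$. A set $F\subseteq E$ is an *odd-circle pseudoforest* if every connected component of the graph $(V,F)$ is either a tree or a connected graph containing exactly one cycle, and this cycle has odd length. Let $\mathcal P_+(G)$ be the set of all odd-circle pseudoforests $F\subseteq E$. An *even circuit* is a graph that is either (a) a cycle of even length, or (b) the union of two distinct odd cycles sharing exactly one vertex, or (c) the union of two vertex-disjoint odd cycles and a path joining a vertex of the first cycle to a vertex of the second one and having no other vertices in common with the two cycles. Fix a linear ordering of $E$. An edge $e\in E$ is *evenly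 active* for $F\in\mathcal P_+(G)$ if $F\cup\{e\}$ contains an even circuit in which $e$ is the smallest edge, and the *even activity* $\mathrm{act}_+(F)$ is the number of edges that are evenly active for $F$. Then: 1. $\dim_K\mathcal C_+(G)=|\mathcal P_+(G)|$ (in particular it is finite). 2. For every $k\ge 0$, $$\dim_K\mathcal C_+^k(G)=\bigl|\{F\in\mathcal P_+(G) : \mathrm{act}_+(F)=|E\setminus F|-k\}\bigr|.$$ -/

import Mathlib

open scoped Graph

/-! ### Algebras attached to a matrix -/

/-- The algebra `K[E]/(x_e^2 : e ∈ E)`. -/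
abbrev SquareFreeAlgebra (K E : Type*) [CommRing K] : Type _ :=
  MvPolynomial E K ⧸ Ideal.span (Set.range fun e : E => (MvPolynomial.X e : MvPolynomial E K) ^ 2)

/-- The class of the edge variable `x_e` in `K[E]/(x_e^2)`. -/
noncomputable def SquareFreeAlgebra.x (K : Type*) {E : Type*} [CommRing K] (e : E) :
    SquareFreeAlgebra K E :=
  Ideal.Quotient.mk _ (MvPolynomial.X e)

/-- The degree `k` part of `K[E]/(x_e^2)`: the classes of homogeneous polynomials of degree `k`. -/
noncomputable def SquareFreeAlgebra.degreePart (K E : Type*) [CommRing K] (k : ℕ) :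
    Submodule K (SquareFreeAlgebra K E) :=
  (MvPolynomial.homogeneousSubmodule E K k).map
    (Ideal.Quotient.mkₐ K (Ideal.span
      (Set.range fun e : E => (MvPolynomial.X e : MvPolynomial E K) ^ 2))).toLinearMap

/-- The circulation algebra of a matrix `A`: the subalgebra of `K[E]/(x_e^2)` generated by the
linear forms `y_v = ∑ e, A v e * x_e`, one for each row `v`. -/
noncomputable def circulationAlgebra {K V E : Type*} [CommRing K] [Fintype E] (A : Matrix V E K) :
    Subalgebra K (SquareFreeAlgebra K E) :=
  Algebra.adjoin K (Set.range fun v : V => ∑ e : E, A v e • SquareFreeAlgebra.x K e)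

/-- The `k`-th graded component of the circulation algebra of `A`, for the grading by degree. -/
noncomputable def circulationAlgebraPart {K V E : Type*} [CommRing K] [Fintype E]
    (A : Matrix V E K) (k : ℕ) : Submodule K (SquareFreeAlgebra K E) :=
  Subalgebra.toSubmodule (circulationAlgebra A) ⊓ SquareFreeAlgebra.degreePart K E k

namespace Graph

variable {α β : Type*}

open Classical in
/-- The undirected incidence matrix: the entry at `(v, e)` is `1` if `e` contains `v`
(in particular if `e` is a loop at `v`) and `0` otherwise. -/
noncomputable def undirectedIncidenceMatrix (K : Type*) [CommRing K] (G : Graph α β) :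
    Matrix V(G) E(G) K :=
  Matrix.of fun v e => if G.Inc e.1 v.1 then 1 else 0

/-! ### Trees, cycles and pseudoforests -/

/-- A graph is connected if it has a vertex and any two vertices are joined by a walk. -/
def IsConnected (G : Graph α β) : Prop :=
  V(G).Nonempty ∧ ∀ x ∈ V(G), ∀ y ∈ V(G), Relation.ReflTransGen G.Adj x y

/-- `H` is a connected component of `G`: a maximal connected subgraph. -/
def IsComponent (G H : Graph α β) : Prop :=
  Maximal (fun H' : Graph α β => H' ≤ G ∧ H'.IsConnected) H

/-- `C` is a cycle with `n ≥ 1` edges: it consists of `n` distinct vertices and `n` distinct edges,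
arranged cyclically. A loop is a cycle of length `1`, and two parallel edges form a cycle of
length `2`. -/
def IsCycleOfLength (C : Graph α β) (n : ℕ) : Prop :=
  0 < n ∧ ∃ (v : ZMod n → α) (e : ZMod n → β), Function.Injective v ∧ Function.Injective e ∧
    V(C) = Set.range v ∧ E(C) = Set.range e ∧ ∀ i, C.IsLink (e i) (v i) (v (i + 1))

/-- `C` is a cycle. -/
def IsCycle (C : Graph α β) : Prop := ∃ n, C.IsCycleOfLength n

/-- `C` is a cycle of odd length. -/
def IsOddCycle (C : Graph α β) : Prop := ∃ n, Odd n ∧ C.IsCycleOfLength n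

/-- `C` is a cycle of even length. -/
def IsEvenCycle (C : Graph α β) : Prop := ∃ n, Even n ∧ C.IsCycleOfLength n

/-- `P` is a path from `x` to `y` (with `n ≥ 0` edges and no repeated vertex). -/
def IsPathBetween (P : Graph α β) (x y : α) : Prop :=
  ∃ (n : ℕ) (v : Fin (n + 1) → α) (e : Fin n → β), Function.Injective v ∧
    V(P) = Set.range v ∧ E(P) = Set.range e ∧ v 0 = x ∧ v (Fin.last n) = y ∧
    ∀ i : Fin n, P.IsLink (e i) (v i.castSucc) (v i.succ)

/-- A tree is a connected graph without cycles. -/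
def IsTreeGraph (T : Graph α β) : Prop :=
  T.IsConnected ∧ ∀ C ≤ T, ¬ C.IsCycle

/-- A unicycle is a connected graph that contains a unique cycle; here this cycle is odd. -/
def IsOddUnicycle (U : Graph α β) : Prop :=
  U.IsConnected ∧ ∃ C ≤ U, C.IsOddCycle ∧ ∀ C' ≤ U, C'.IsCycle → C' = C

/-- The set of odd-circle pseudoforests of `G`: sets `F` of edges such that each component of the
spanning subgraph of `G` with edge set `F` is a tree or a unicycle whose cycle is odd.
(Vertices not covered by `F` give one-vertex trees.) -/
def oddCirclePseudoforests (G : Graph α β) : Set (Set β) :=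
  {F | F ⊆ E(G) ∧ ∀ H, (G.restrict F).IsComponent H → H.IsTreeGraph ∨ H.IsOddUnicycle}

/-! ### Even circuits and even activity -/

/-- `D` is the union of two distinct odd cycles that share exactly one vertex. -/
def IsOddFigureEight (D : Graph α β) : Prop :=
  ∃ C₁ ≤ D, ∃ C₂ ≤ D, C₁.IsOddCycle ∧ C₂.IsOddCycle ∧ C₁ ≠ C₂ ∧
    (∃ x, V(C₁) ∩ V(C₂) = {x}) ∧ V(D) = V(C₁) ∪ V(C₂) ∧ E(D) = E(C₁) ∪ E(C₂)

/-- `D` is the union of two vertex-disjoint odd cycles and a path that joins a vertex `x` of the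
first to a vertex `y` of the second and has no other vertex in common with the two cycles. -/
def IsOddHandcuff (D : Graph α β) : Prop :=
  ∃ C₁ ≤ D, ∃ C₂ ≤ D, ∃ P ≤ D, ∃ x y, C₁.IsOddCycle ∧ C₂.IsOddCycle ∧ P.IsPathBetween x y ∧
    Disjoint V(C₁) V(C₂) ∧ V(P) ∩ V(C₁) = {x} ∧ V(P) ∩ V(C₂) = {y} ∧
    V(D) = V(C₁) ∪ V(C₂) ∪ V(P) ∧ E(D) = E(C₁) ∪ E(C₂) ∪ E(P)

/-- The three types of even circuits. -/
def IsEvenCircuit (D : Graph α β) : Prop :=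
  D.IsEvenCycle ∨ D.IsOddFigureEight ∨ D.IsOddHandcuff

/-- The edge `e` is evenly active for `F`: the graph `F ∪ {e}` contains an even circuit in which
`e` is the smallest edge. -/
def IsEvenlyActive (G : Graph α β) [LinearOrder E(G)] (F : Set β) (e : E(G)) : Prop :=
  ∃ D ≤ G.restrict (F ∪ {e.1}), D.IsEvenCircuit ∧ e.1 ∈ E(D) ∧ ∀ f : E(G), f.1 ∈ E(D) → e ≤ f

/-- The even activity of `F`: the number of evenly active edges. -/
noncomputable def evenActivity (G : Graph α β) [LinearOrder E(G)] (F : Set β) : ℕ :=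
  {e : E(G) | G.IsEvenlyActive F e}.ncard

end Graph

/-! Write `a e` for the column of the incidence matrix at `e`, viewed as a linear form in variables
indexed by the vertices. The proof has three layers.

Duality. Substituting the `y_v` into a polynomial `f` and reading off the coefficient of the
square-free monomial of `S` gives `f(∂)` applied to `∏ e ∈ S, a e` and evaluated at `0`
(`coeff_flowEval`). The relations between the `y_v` are therefore the annihilator of the space
spanned by these products. In characteristic zero the pairing is nondegenerate, so the algebra and
that space have equal dimension, also degree by degree (`finrank_range_eq_prodSpan`).

Deletion and contraction. The span of the products over `S ⊆ T` is the space of polynomials whose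
degree in every direction `w` is at most the number of forms of `T` not vanishing at `w`
(`mem_prodSpan_iff_isBounded`). This makes multiplication by `a e₀` and restriction to its kernel
into a short exact sequence: the space for `T` with degrees shifted by one, the space for `T ∪
{e₀}`, the space for the contraction. If `e₀` is the largest element, independent sets `F`, weighted
by the number of elements outside `F` that are not externally active, obey the same recursion,
according to whether `e₀ ∉ F` or `e₀ ∈ F`. Hence `finrank_prodSpan`, for any family of vectors over
an infinite field.

Graphs. The columns at the edges of `F` are independent iff the equations `f x + f y = g e` on these
edges can be solved for every `g`. An even circuit obstructs solvability
(`IsEvenCircuit.not_isSolvable`). A connected graph without even circuits is a tree or an odd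
unicycle (`tree_or_unicycle_of_no_evenCircuit`), and for finite graphs of these kinds counting
dimensions yields solvability. So independent sets are odd-circle pseudoforests, and external
activity is even activity (`isEvenlyActive_iff`). -/

namespace PowerIdeal

/-! ### Linear forms, directional shifts and projections. -/

open MvPolynomial

variable {K σ E : Type*} [Field K] [Fintype σ]

/-- The linear form with coefficient vector `a`. -/
noncomputable def linForm (a : σ → K) : MvPolynomial σ K := ∑ i, C (a i) * X i

/-- The substitution `x ↦ x + t w`, as a polynomial in the new variable `t`. -/
noncomputable def shift (w : σ → K) : MvPolynomial σ K →ₐ[K] Polynomial (MvPolynomial σ K) :=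
  aeval fun i => Polynomial.C (X i) + Polynomial.C (C (w i)) * Polynomial.X

/-- The substitution `x ↦ x - b(x) u`; a projection along `u` to the kernel of `b` if `b(u) = 1`. -/
noncomputable def proj (b u : σ → K) : MvPolynomial σ K →ₐ[K] MvPolynomial σ K :=
  aeval fun i => X i - C (u i) * linForm b

/-- The span of the products of linear forms `∏ e ∈ S, a e` with `S ⊆ T` of cardinality in `κ`. -/
noncomputable def prodSpan (a : E → σ → K) (T : Finset E) (κ : Set ℕ) :
    Submodule K (MvPolynomial σ K) :=
  Submodule.span K ((fun S : Finset E => ∏ e ∈ S, linForm (a e)) '' {S | S ⊆ T ∧ S.card ∈ κ})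

lemma linForm_homogeneous (a : σ → K) : (linForm a).IsHomogeneous 1 :=
  IsHomogeneous.sum _ _ _ fun i _ => by
    simpa using (isHomogeneous_C σ (a i)).mul (isHomogeneous_X K i)

lemma linForm_sub_smul (a b : σ → K) (c : K) :
    linForm (a - c • b) = linForm a - C c * linForm b := by
  simp [linForm, sub_mul, Finset.sum_sub_distrib, Finset.mul_sum, mul_assoc]

lemma shift_linForm (a w : σ → K) :
    shift w (linForm a) =
      Polynomial.C (linForm a) + Polynomial.C (C (a ⬝ᵥ w)) * Polynomial.X := by
  simp only [linForm, shift, map_sum, map_mul, aeval_X, algHom_C, dotProduct]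
  simp only [Polynomial.algebraMap_apply, MvPolynomial.algebraMap_eq, mul_add,
    Finset.sum_add_distrib, Finset.sum_mul, mul_assoc]

lemma proj_linForm (a b u : σ → K) :
    proj b u (linForm a) = linForm (a - (a ⬝ᵥ u) • b) := by
  rw [linForm_sub_smul]
  simp only [linForm, proj, map_sum, map_mul, aeval_X, algHom_C, dotProduct,
    MvPolynomial.algebraMap_eq, mul_sub, Finset.sum_sub_distrib, Finset.sum_mul, mul_assoc]

lemma linForm_ne_zero {b : σ → K} (hb : b ≠ 0) : linForm b ≠ 0 := by
  classical
  obtain ⟨i, hi⟩ := Function.ne_iff.1 hb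
  intro h
  apply hi
  have := congrArg (MvPolynomial.eval (Pi.single i 1)) h
  simpa [linForm, Pi.single_apply] using this

/-- If `b ⬝ᵥ u = 1`, the vector `w - (b ⬝ᵥ w) • u` is the projection of `w` to the kernel of `b`.
Directional degrees of a projected polynomial are thus controlled by those of `f` in directions
inside this kernel. -/
lemma shift_proj (b u w : σ → K) (f : MvPolynomial σ K) :
    shift w (proj b u f) =
      (shift (w - (b ⬝ᵥ w) • u) f).map (proj b u : MvPolynomial σ K →+* MvPolynomial σ K) := by
  have : (shift w).comp (proj b u) =
      (Polynomial.mapAlgHom (proj b u)).comp (shift (w - (b ⬝ᵥ w) • u)) := by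
    ext1 i
    have h1 : proj b u (X i) = X i - C (u i) * linForm b := by simp [proj]
    have h2 : ∀ w : σ → K, shift w (X i : MvPolynomial σ K) =
        Polynomial.C (X i) + Polynomial.C (C (w i)) * Polynomial.X := by simp [shift]
    have h3 : ∀ (w : σ → K) (c : K), shift w (C c : MvPolynomial σ K) = Polynomial.C (C c) := by
      intro w c; simp [shift, algHom_C]
    simp only [AlgHom.comp_apply, h1, map_sub, map_mul, h2, h3, shift_linForm]
    simp [h1, Polynomial.coe_mapAlgHom]
    ring
  simpa using DFunLike.congr_fun this f

-- Used with `c = 0` for projections and with `c = 1` for multiplication by a linear form.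
omit [Fintype σ] in
lemma homogeneousComponent_map {φ : MvPolynomial σ K →ₗ[K] MvPolynomial σ K} {c : ℕ}
    (hφ : ∀ n f, f.IsHomogeneous n → (φ f).IsHomogeneous (n + c)) (n : ℕ) (f : MvPolynomial σ K) :
    homogeneousComponent (n + c) (φ f) = φ (homogeneousComponent n f) := by
  conv_lhs => rw [← sum_homogeneousComponent f]
  rw [map_sum, map_sum]
  rw [Finset.sum_congr rfl fun i _ => homogeneousComponent_of_mem
    (hφ i _ (homogeneousComponent_isHomogeneous i f))]
  simp only [Nat.add_right_cancel_iff, Finset.sum_ite_eq, Finset.mem_range]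
  split_ifs with h
  · rfl
  · rw [homogeneousComponent_eq_zero _ _ (by omega), map_zero]

lemma homogeneousComponent_proj (b u : σ → K) (n : ℕ) (f : MvPolynomial σ K) :
    homogeneousComponent n (proj b u f) = proj b u (homogeneousComponent n f) := by
  refine homogeneousComponent_map (φ := (proj b u).toLinearMap) (c := 0) (fun n f hf => ?_) n f
  have := hf.aeval (fun i => X i - C (u i) * linForm b) (n := 1) fun i => (isHomogeneous_X K i).sub
    (by simpa using (isHomogeneous_C σ (u i)).mul (linForm_homogeneous b))
  rw [one_mul] at this
  exact this

lemma homogeneousComponent_linForm_mul (b : σ → K) (n : ℕ) (f : MvPolynomial σ K) :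
    homogeneousComponent (n + 1) (linForm b * f) = linForm b * homogeneousComponent n f :=
  homogeneousComponent_map (φ := LinearMap.mulLeft K (linForm b)) (c := 1)
    (fun n f hf => by simpa [add_comm] using (linForm_homogeneous b).mul hf) n f

lemma linForm_dvd_sub_proj (b u : σ → K) (f : MvPolynomial σ K) :
    linForm b ∣ f - proj b u f := by
  induction f using MvPolynomial.induction_on with
  | C c => simp [proj, algHom_C]
  | add p q hp hq =>
    rw [map_add, add_sub_add_comm]
    exact dvd_add hp hq
  | mul_X p i hp =>
    have h1 : proj b u (X i) = X i - C (u i) * linForm b := by simp [proj]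
    rw [map_mul, h1]
    have : p * X i - proj b u p * (X i - C (u i) * linForm b) =
        (p - proj b u p) * X i + linForm b * (C (u i) * proj b u p) := by ring
    rw [this]
    exact dvd_add (hp.mul_right _) (dvd_mul_right _ _)

lemma proj_linForm_self {b u : σ → K} (hu : b ⬝ᵥ u = 1) : proj b u (linForm b) = 0 := by
  rw [proj_linForm, hu]; simp [linForm]

lemma proj_eq_zero_iff {b u : σ → K} (hu : b ⬝ᵥ u = 1) (f : MvPolynomial σ K) :
    proj b u f = 0 ↔ linForm b ∣ f := by
  constructor
  · intro h
    simpa [h] using linForm_dvd_sub_proj b u f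
  · rintro ⟨g, rfl⟩
    rw [map_mul, proj_linForm_self hu, zero_mul]

lemma natDegree_shift_linForm (a w : σ → K) [DecidableEq K] :
    (shift w (linForm a)).natDegree = if a ⬝ᵥ w = 0 then 0 else 1 := by
  rw [shift_linForm]
  split_ifs with h
  · simp [h]
  · rw [add_comm]
    exact Polynomial.natDegree_linear (by simpa using h)

end PowerIdeal

/-! ### Spans of products of linear forms, characterised by directional degrees. -/

namespace PowerIdeal

open MvPolynomial

variable {K σ E : Type*} [Field K] [Fintype σ]

open Classical in
/-- Polynomials with homogeneous components in degrees in `κ`, whose degree in each direction `w`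
is at most the number of forms `a e`, `e ∈ T`, that do not vanish on `w`. -/
def IsBounded (a : E → σ → K) (T : Finset E) (κ : Set ℕ) (f : MvPolynomial σ K) : Prop :=
  (∀ j ∉ κ, homogeneousComponent j f = 0) ∧
    ∀ w, (shift w f).natDegree ≤ (T.filter fun e => a e ⬝ᵥ w ≠ 0).card

/-- Each factor `a e` has degree one in the direction `w` if `a e ⬝ᵥ w ≠ 0` and degree zero
otherwise. -/
lemma isBounded_of_mem_prodSpan {a : E → σ → K} {T : Finset E} {κ : Set ℕ} {f : MvPolynomial σ K}
    (hf : f ∈ prodSpan a T κ) : IsBounded a T κ f := by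
  classical
  induction hf using Submodule.span_induction with
  | mem f hf =>
    obtain ⟨S, ⟨hST, hSκ⟩, rfl⟩ := hf
    refine ⟨fun j hj => ?_, fun w => ?_⟩
    · have h := IsHomogeneous.prod S (fun e => linForm (a e)) (fun _ => 1)
        fun e _ => linForm_homogeneous (a e)
      simp only [Finset.sum_const, smul_eq_mul, mul_one] at h
      rw [homogeneousComponent_of_mem h, if_neg]
      rintro rfl
      exact hj hSκ
    · simp only [map_prod]
      refine (Polynomial.natDegree_prod_le _ _).trans ?_
      calc ∑ e ∈ S, (shift w (linForm (a e))).natDegree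
          = ∑ e ∈ S, if a e ⬝ᵥ w ≠ 0 then 1 else 0 :=
            Finset.sum_congr rfl fun e _ => by rw [natDegree_shift_linForm]; simp
        _ ≤ ∑ e ∈ T, if a e ⬝ᵥ w ≠ 0 then 1 else 0 :=
            Finset.sum_le_sum_of_subset hST
        _ = _ := by rw [Finset.card_filter]
  | zero => exact ⟨fun j _ => map_zero _, fun w => by simp⟩
  | add f g _ _ hf hg =>
    refine ⟨fun j hj => by rw [map_add, hf.1 j hj, hg.1 j hj, add_zero], fun w => ?_⟩
    rw [map_add]
    exact Polynomial.natDegree_add_le_of_degree_le (hf.2 w) (hg.2 w)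
  | smul c f _ hf =>
    refine ⟨fun j hj => by rw [map_smul, hf.1 j hj, smul_zero], fun w => ?_⟩
    rw [map_smul]
    exact (Polynomial.natDegree_smul_le _ _).trans (hf.2 w)

lemma IsBounded.sub {a : E → σ → K} {T : Finset E} {κ : Set ℕ} {f g : MvPolynomial σ K}
    (hf : IsBounded a T κ f) (hg : IsBounded a T κ g) : IsBounded a T κ (f - g) := by
  refine ⟨fun j hj => by rw [map_sub, hf.1 j hj, hg.1 j hj, sub_zero], fun w => ?_⟩
  rw [map_sub]
  exact Polynomial.natDegree_sub_le_of_le (hf.2 w) (hg.2 w) |>.trans (max_self _).le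

/-- The image of `prodSpan` under the projection along `u` to the kernel of one of the forms. -/
lemma map_proj_prodSpan [DecidableEq E] {a : E → σ → K} {T : Finset E} {κ : Set ℕ} {e₀ : E}
    {u : σ → K} (hu : a e₀ ⬝ᵥ u = 1) :
    (prodSpan a (insert e₀ T) κ).map (proj (a e₀) u).toLinearMap =
      prodSpan (fun e => a e - (a e ⬝ᵥ u) • a e₀) T κ := by
  have key : ∀ S : Finset E, proj (a e₀) u (∏ e ∈ S, linForm (a e)) =
      ∏ e ∈ S, linForm (a e - (a e ⬝ᵥ u) • a e₀) := by
    intro S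
    rw [map_prod]
    exact Finset.prod_congr rfl fun e _ => proj_linForm _ _ _
  apply le_antisymm
  · rw [prodSpan, Submodule.map_span_le]
    rintro _ ⟨S, ⟨hS, hSκ⟩, rfl⟩
    by_cases h : e₀ ∈ S
    · have : proj (a e₀) u (∏ e ∈ S, linForm (a e)) = 0 := by
        rw [map_prod]
        exact Finset.prod_eq_zero h (proj_linForm_self hu)
      simp [this]
    · simp only [AlgHom.toLinearMap_apply, key]
      exact Submodule.subset_span ⟨S, ⟨(Finset.subset_insert_iff_of_notMem h).1 hS, hSκ⟩, rfl⟩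
  · rw [prodSpan, Submodule.span_le]
    rintro _ ⟨S, ⟨hS, hSκ⟩, rfl⟩
    exact ⟨_, Submodule.subset_span ⟨S, ⟨hS.trans (Finset.subset_insert _ _), hSκ⟩, rfl⟩, key S⟩

/-- The contracted form of `e` takes at `w` the value of `a e` at the projection of `w` to the
kernel of `a e₀`. There `a e₀` itself vanishes, so `e₀` drops out of the bound. -/
lemma IsBounded.proj [DecidableEq E] {a : E → σ → K} {T : Finset E} {κ : Set ℕ} {e₀ : E}
    {u : σ → K} (hu : a e₀ ⬝ᵥ u = 1)
    {f : MvPolynomial σ K} (hf : IsBounded a (insert e₀ T) κ f) :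
    IsBounded (fun e => a e - (a e ⬝ᵥ u) • a e₀) T κ (proj (a e₀) u f) := by
  refine ⟨fun j hj => by rw [homogeneousComponent_proj, hf.1 j hj, map_zero], fun w => ?_⟩
  rw [shift_proj]
  refine Polynomial.natDegree_map_le.trans ((hf.2 _).trans (Finset.card_le_card ?_))
  intro e
  simp only [Finset.mem_filter, Finset.mem_insert, sub_dotProduct, dotProduct_sub, smul_dotProduct,
    dotProduct_smul, smul_eq_mul]
  rintro ⟨rfl | he, h⟩
  · simp [hu] at h
  · exact ⟨he, by simpa [mul_comm] using h⟩

/-- Dividing by a form. -/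
lemma IsBounded.of_mul [DecidableEq E] {a : E → σ → K} {T : Finset E} {κ : Set ℕ} {e₀ : E}
    (he₀ : e₀ ∉ T) (h0 : a e₀ ≠ 0) {g : MvPolynomial σ K}
    (hf : IsBounded a (insert e₀ T) κ (linForm (a e₀) * g)) :
    IsBounded a T {j | j + 1 ∈ κ} g := by
  classical
  refine ⟨fun j hj => ?_, fun w => ?_⟩
  · have := hf.1 (j + 1) hj
    rw [homogeneousComponent_linForm_mul] at this
    exact (mul_eq_zero.1 this).resolve_left (linForm_ne_zero h0)
  · have := hf.2 w
    by_cases hg : shift w g = 0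
    · simp [hg]
    have hl : shift w (linForm (a e₀)) ≠ 0 := by
      rw [shift_linForm]
      intro h
      have := congrArg (Polynomial.coeff · 0) h
      simp at this
      exact linForm_ne_zero h0 this
    rw [map_mul, Polynomial.natDegree_mul hl hg, natDegree_shift_linForm,
      Finset.filter_insert] at this
    by_cases hw : a e₀ ⬝ᵥ w = 0
    · simpa [hw] using this
    · have h2 : e₀ ∉ T.filter fun e => a e ⬝ᵥ w ≠ 0 := fun h => he₀ (Finset.mem_filter.1 h).1
      simp only [hw, if_false, ne_eq, not_false_eq_true, if_true] at this
      rw [Finset.card_insert_of_notMem (by simpa using fun h => absurd h he₀)] at this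
      have h3 : ∀ x y : ℕ, 1 + x ≤ y + 1 → x ≤ y := by omega
      exact h3 _ _ this

lemma prodSpan_mono {a : E → σ → K} {S T : Finset E} (h : S ⊆ T) (κ : Set ℕ) :
    prodSpan a S κ ≤ prodSpan a T κ :=
  Submodule.span_mono (Set.image_mono fun _ hS => ⟨hS.1.trans h, hS.2⟩)

lemma linForm_mul_mem_prodSpan [DecidableEq E] {a : E → σ → K} {T : Finset E} {κ : Set ℕ} {e₀ : E}
    (he₀ : e₀ ∉ T) {g : MvPolynomial σ K} (hg : g ∈ prodSpan a T {j | j + 1 ∈ κ}) :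
    linForm (a e₀) * g ∈ prodSpan a (insert e₀ T) κ := by
  have : (prodSpan a T {j | j + 1 ∈ κ}).map (LinearMap.mulLeft K (linForm (a e₀))) ≤
      prodSpan a (insert e₀ T) κ := by
    rw [prodSpan, Submodule.map_span_le]
    rintro _ ⟨S, ⟨hS, hSκ⟩, rfl⟩
    refine Submodule.subset_span ⟨insert e₀ S, ⟨Finset.insert_subset_insert _ hS, ?_⟩, ?_⟩
    · rwa [Finset.card_insert_of_notMem fun h => he₀ (hS h)]
    · exact Finset.prod_insert fun h => he₀ (hS h)
  exact this ⟨g, hg, rfl⟩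

lemma exists_dotProduct_eq_one {b : σ → K} (hb : b ≠ 0) : ∃ u, b ⬝ᵥ u = 1 := by
  classical
  obtain ⟨i, hi⟩ := Function.ne_iff.1 hb
  exact ⟨Pi.single i (b i)⁻¹, by rw [dotProduct_single]; exact mul_inv_cancel₀ hi⟩

variable [Infinite K]

/-- With no forms, the degree in every direction is zero, so the polynomial is constant on every
line through the origin and hence constant. -/
lemma isBounded_empty {a : E → σ → K} {κ : Set ℕ} {f : MvPolynomial σ K}
    (hf : IsBounded a ∅ κ f) : f ∈ prodSpan a ∅ κ := by
  have hC : f = C (eval 0 f) := by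
    apply MvPolynomial.funext
    intro w
    have h := hf.2 w
    simp only [Finset.filter_empty, Finset.card_empty, nonpos_iff_eq_zero] at h
    have h1 := Polynomial.eq_C_of_natDegree_eq_zero h
    have h2 : ∀ t : K, eval (t • w) f =
        Polynomial.eval t ((shift w f).map (eval (0 : σ → K))) := by
      intro t
      have : (aeval (t • w) : MvPolynomial σ K →ₐ[K] K) =
          ((Polynomial.aeval t).comp (Polynomial.mapAlgHom (aeval (0 : σ → K)))).comp
            (shift w) := by
        ext i
        simp only [AlgHom.comp_apply, shift, aeval_X]
        simp [mul_comm (w i)]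
      have := DFunLike.congr_fun this f
      simp only [AlgHom.comp_apply, Polynomial.coe_mapAlgHom, Polynomial.coe_aeval_eq_eval] at this
      exact this
    -- The values at `w` and at `0` are those at parameters `1` and `0` of a constant polynomial.
    have h3 := h2 1
    have h4 := h2 0
    rw [h1] at h3 h4
    simp only [one_smul, zero_smul, Polynomial.map_C, Polynomial.eval_C] at h3 h4
    rw [h3, ← h4, eval_C]
  by_cases h0 : 0 ∈ κ
  · have : (1 : MvPolynomial σ K) ∈ prodSpan a ∅ κ :=
      Submodule.subset_span ⟨∅, ⟨le_rfl, by simpa using h0⟩, by simp⟩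
    rw [hC, ← mul_one (C _), ← smul_eq_C_mul]
    exact Submodule.smul_mem _ _ this
  · have := hf.1 0 h0
    rw [hC, homogeneousComponent_zero, coeff_zero_C] at this
    rw [hC, this]
    exact zero_mem _

/-- For the converse, the projection of `f` is bounded for the contraction, so by induction it lifts
to some `p` in the span. Then `f - p` is a multiple of the form at `e₀`, and the quotient is bounded
for the deletion. -/
lemma mem_prodSpan_iff_isBounded {a : E → σ → K} {T : Finset E} {κ : Set ℕ}
    {f : MvPolynomial σ K} : f ∈ prodSpan a T κ ↔ IsBounded a T κ f := by
  classical
  refine ⟨isBounded_of_mem_prodSpan, ?_⟩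
  induction T using Finset.induction_on generalizing a κ f with
  | empty => exact isBounded_empty
  | insert e₀ T he₀ ih =>
    intro hf
    by_cases h0 : a e₀ = 0
    · refine prodSpan_mono (Finset.subset_insert e₀ T) κ (ih ⟨hf.1, fun w => ?_⟩)
      have := hf.2 w
      rw [Finset.filter_insert] at this
      simpa [h0] using this
    obtain ⟨u, hu⟩ := exists_dotProduct_eq_one h0
    have h1 := ih (hf.proj hu)
    rw [← map_proj_prodSpan hu] at h1
    obtain ⟨p, hp, hpf⟩ := h1
    have h2 : proj (a e₀) u (f - p) = 0 := by
      rw [map_sub, sub_eq_zero]; exact hpf.symm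
    obtain ⟨g, hg⟩ := (proj_eq_zero_iff hu _).1 h2
    have h3 := hf.sub (isBounded_of_mem_prodSpan hp)
    rw [hg] at h3
    have h4 := linForm_mul_mem_prodSpan he₀ (ih (h3.of_mul he₀ h0))
    rw [← hg] at h4
    simpa using add_mem h4 hp

instance (a : E → σ → K) (T : Finset E) (κ : Set ℕ) : Module.Finite K (prodSpan a T κ) :=
  FiniteDimensional.span_of_finite K
    ((T.powerset.finite_toSet.subset fun _ hS =>
      Finset.mem_coe.2 (Finset.mem_powerset.2 hS.1)).image _)

/-- Rank and nullity of the projection along `u`: its image is the contraction, its kernel is a copy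
of the deletion. -/
lemma finrank_prodSpan_insert [DecidableEq E] {a : E → σ → K} {T : Finset E} {κ : Set ℕ} {e₀ : E}
    (he₀ : e₀ ∉ T) {u : σ → K} (hu : a e₀ ⬝ᵥ u = 1) :
    Module.finrank K (prodSpan a (insert e₀ T) κ) =
      Module.finrank K (prodSpan a T {j | j + 1 ∈ κ}) +
      Module.finrank K (prodSpan (fun e => a e - (a e ⬝ᵥ u) • a e₀) T κ) := by
  have h0 : a e₀ ≠ 0 := by rintro h; simp [h] at hu
  set φ := (proj (a e₀) u).toLinearMap.domRestrict (prodSpan a (insert e₀ T) κ)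
  have h1 := φ.finrank_range_add_finrank_ker
  have h2 : LinearMap.range φ = prodSpan (fun e => a e - (a e ⬝ᵥ u) • a e₀) T κ := by
    rw [LinearMap.range_domRestrict, map_proj_prodSpan hu]
  -- That the quotient of a kernel element by `a e₀` is again a combination of products is not
  -- visible from the generators; it follows from the degree characterisation.
  have h3 : (LinearMap.ker φ).map (prodSpan a (insert e₀ T) κ).subtype =
      (prodSpan a T {j | j + 1 ∈ κ}).map (LinearMap.mulLeft K (linForm (a e₀))) := by
    ext f
    constructor
    · rintro ⟨⟨f, hf⟩, hk, rfl⟩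
      obtain ⟨g, rfl⟩ := (proj_eq_zero_iff hu f).1 hk
      exact ⟨g, mem_prodSpan_iff_isBounded.2 ((mem_prodSpan_iff_isBounded.1 hf).of_mul he₀ h0), rfl⟩
    · rintro ⟨g, hg, rfl⟩
      exact ⟨⟨_, linForm_mul_mem_prodSpan he₀ hg⟩, (proj_eq_zero_iff hu _).2 (dvd_mul_right _ _),
        rfl⟩
  have h4 : Module.finrank K (LinearMap.ker φ) =
      Module.finrank K (prodSpan a T {j | j + 1 ∈ κ}) := by
    rw [← Submodule.finrank_map_subtype_eq, h3]
    exact (Submodule.equivMapOfInjective _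
      (mul_right_injective₀ (linForm_ne_zero h0)) _).finrank_eq.symm
  rw [← h1, h2, h4, add_comm]

end PowerIdeal

/-! ### Deletion and contraction for independent sets counted by external activity. -/

namespace PowerIdeal

open MvPolynomial

section Count

variable {K V E : Type*} [Field K] [AddCommGroup V] [Module K V] [LinearOrder E]

open Classical in
/-- The elements `e` of `T` for which `a e` is not in the span of the `a f` with `f ∈ F`
larger than `e`. -/
noncomputable def nonactive (K : Type*) {V E : Type*} [Field K] [AddCommGroup V] [Module K V]
    [LinearOrder E] (a : E → V) (T F : Finset E) : Finset E :=
  T.filter fun e => a e ∉ Submodule.span K (a '' {f | f ∈ F ∧ e < f})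

open Classical in
/-- The independent subsets `F` of `T` for which the number of elements of `T \ F` that are not
externally active lies in `κ`. -/
noncomputable def indepSets (K : Type*) {V E : Type*} [Field K] [AddCommGroup V] [Module K V]
    [LinearOrder E] (a : E → V) (T : Finset E) (κ : Set ℕ) : Finset (Finset E) :=
  T.powerset.filter fun F => F ⊆ nonactive K a T F ∧ (nonactive K a T F \ F).card ∈ κ

lemma mem_indepSets {a : E → V} {T F : Finset E} {κ : Set ℕ} :
    F ∈ indepSets K a T κ ↔
      F ⊆ T ∧ F ⊆ nonactive K a T F ∧ (nonactive K a T F \ F).card ∈ κ := by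
  classical
  simp only [indepSets, Finset.mem_filter, Finset.mem_powerset]

lemma card_indepSets_insert (a : E → V) (T : Finset E) (κ : Set ℕ) {e₀ : E} (h : e₀ ∉ T) :
    (indepSets K a (insert e₀ T) κ).card =
      (T.powerset.filter fun F => F ∈ indepSets K a (insert e₀ T) κ).card +
      (T.powerset.filter fun F => insert e₀ F ∈ indepSets K a (insert e₀ T) κ).card := by
  classical
  have h1 : indepSets K a (insert e₀ T) κ =
      (T.powerset.filter fun F => F ∈ indepSets K a (insert e₀ T) κ) ∪
      (T.powerset.filter fun F => insert e₀ F ∈ indepSets K a (insert e₀ T) κ).image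
        (insert e₀) := by
    ext F
    simp only [Finset.mem_union, Finset.mem_filter, Finset.mem_image, Finset.mem_powerset]
    constructor
    · intro hF
      have hFT : F ⊆ insert e₀ T := by
        rw [indepSets, Finset.mem_filter, Finset.mem_powerset] at hF
        exact hF.1
      by_cases he : e₀ ∈ F
      · refine Or.inr ⟨F.erase e₀, ⟨by rwa [← Finset.subset_insert_iff], ?_⟩,
          Finset.insert_erase he⟩
        rwa [Finset.insert_erase he]
      · exact Or.inl ⟨(Finset.subset_insert_iff_of_notMem he).1 hFT, hF⟩
    · rintro (hF | ⟨F, hF, rfl⟩)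
      exacts [hF.2, hF.2]
  conv_lhs => rw [h1]
  rw [Finset.card_union_of_disjoint, Finset.card_image_of_injOn]
  · intro F hF F' hF' hFF
    simp only [Finset.coe_filter, Finset.mem_powerset, Set.mem_ofPred_eq] at hF hF'
    have h2 : e₀ ∉ F := fun hh => h (hF.1 hh)
    have h3 : e₀ ∉ F' := fun hh => h (hF'.1 hh)
    have := congrArg (Finset.erase · e₀) hFF
    simpa [Finset.erase_insert h2, Finset.erase_insert h3] using this
  · rw [Finset.disjoint_left]
    intro F hF hF'
    simp only [Finset.mem_filter, Finset.mem_image, Finset.mem_powerset] at hF hF'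
    obtain ⟨F', _, rfl⟩ := hF'
    exact h (hF.1 (Finset.mem_insert_self _ _))

variable {a : E → V} {T : Finset E} {κ : Set ℕ} {e₀ : E}

omit [AddCommGroup V] in
lemma image_gt_eq_empty (hmax : ∀ x ∈ T, x < e₀) {F : Finset E} (hF : F ⊆ insert e₀ T) :
    a '' {f | f ∈ F ∧ e₀ < f} = ∅ := by
  rw [Set.image_eq_empty, Set.eq_empty_iff_forall_notMem]
  rintro x ⟨hx, hlt⟩
  rcases Finset.mem_insert.1 (hF hx) with rfl | hx
  · exact lt_irrefl _ hlt
  · exact lt_asymm hlt (hmax x hx)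

lemma nonactive_insert_of_zero (h0 : a e₀ = 0) (F : Finset E) :
    nonactive K a (insert e₀ T) F = nonactive K a T F := by
  rw [nonactive, Finset.filter_insert, if_neg]
  · rfl
  · simp [h0]

/-- No element of `F` exceeds `e₀`, so the span tested for `e₀` is zero. -/
lemma nonactive_insert (hmax : ∀ x ∈ T, x < e₀) (h0 : a e₀ ≠ 0) {F : Finset E}
    (hF : F ⊆ insert e₀ T) :
    nonactive K a (insert e₀ T) F = insert e₀ (nonactive K a T F) := by
  rw [nonactive, Finset.filter_insert, if_pos]
  · rfl
  · rw [image_gt_eq_empty hmax hF]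
    simpa using h0

/-- Since `e₀` exceeds all of `T`, its vector belongs to every span that is tested; membership can
then be tested modulo `a e₀`, that is, after applying `φ`. -/
lemma nonactive_insert_insert (hmax : ∀ x ∈ T, x < e₀) {a' : E → V} (φ : V →ₗ[K] V)
    (hφ : LinearMap.ker φ = Submodule.span K {a e₀}) (ha' : ∀ e, a' e = φ (a e)) (F : Finset E) :
    nonactive K a T (insert e₀ F) = nonactive K a' T F := by
  classical
  rw [nonactive, nonactive]
  refine Finset.filter_congr fun e he => not_congr ?_
  have h1 : a '' {f | f ∈ insert e₀ F ∧ e < f} = a '' {f | f ∈ F ∧ e < f} ∪ {a e₀} := by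
    rw [← Set.image_singleton, ← Set.image_union]
    congr 1
    ext f
    simp only [Finset.mem_insert, Set.mem_ofPred_eq, Set.mem_union, Set.mem_singleton_iff]
    constructor
    · tauto
    · rintro (h | rfl)
      · tauto
      · exact ⟨Or.inl rfl, hmax e he⟩
  have h2 : a' '' {f | f ∈ F ∧ e < f} = φ '' (a '' {f | f ∈ F ∧ e < f}) := by
    rw [Set.image_image]
    exact Set.image_congr fun f _ => ha' f
  rw [h1, h2, Submodule.span_union, ← hφ, ← Submodule.comap_map_eq, Submodule.map_span,
    Submodule.mem_comap, ha']

lemma card_indepSets_of_zero (h : e₀ ∉ T) (h0 : a e₀ = 0) :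
    (indepSets K a (insert e₀ T) κ).card = (indepSets K a T κ).card := by
  classical
  rw [card_indepSets_insert a T κ h, Finset.filter_false_of_mem (p := fun F => insert e₀ F ∈ _)]
  · rw [Finset.card_empty, add_zero]
    congr 1
    ext F
    simp only [indepSets, Finset.mem_filter, Finset.mem_powerset, nonactive_insert_of_zero h0]
    have := Finset.subset_insert e₀ T
    constructor
    · tauto
    · exact fun h => ⟨h.1, h.1.trans this, h.2⟩
  · intro F _ hF
    simp only [indepSets, Finset.mem_filter, nonactive_insert_of_zero h0] at hF
    have := hF.2.1 (Finset.mem_insert_self _ _)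
    exact h (Finset.mem_filter.1 this).1

/-- If `e₀ ∉ F`, then `e₀` is one more nonactive element outside `F`, which shifts `κ` by one. If
`e₀ ∈ F`, the remaining elements are judged in the contraction and the count is unchanged. -/
lemma card_indepSets_of_ne_zero (hmax : ∀ x ∈ T, x < e₀) (h0 : a e₀ ≠ 0) {a' : E → V}
    (φ : V →ₗ[K] V) (hφ : LinearMap.ker φ = Submodule.span K {a e₀})
    (ha' : ∀ e, a' e = φ (a e)) :
    (indepSets K a (insert e₀ T) κ).card =
      (indepSets K a T {j | j + 1 ∈ κ}).card + (indepSets K a' T κ).card := by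
  classical
  have h : e₀ ∉ T := fun h => lt_irrefl _ (hmax _ h)
  have hn : ∀ (a : E → V) F, e₀ ∉ nonactive K a T F := fun a F hF => h (Finset.mem_filter.1 hF).1
  rw [card_indepSets_insert a T κ h]
  congr 2
  · ext F
    simp only [indepSets, Finset.mem_filter, Finset.mem_powerset, Set.mem_ofPred_eq]
    refine and_congr_right fun hF => ?_
    have hF' := hF.trans (Finset.subset_insert e₀ T)
    have he : e₀ ∉ F := fun hh => h (hF hh)
    rw [nonactive_insert hmax h0 hF', Finset.subset_insert_iff_of_notMem (t := nonactive K a T F) he,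
      Finset.insert_sdiff_of_notMem _ he, Finset.card_insert_of_notMem]
    · tauto
    · exact fun hh => hn _ _ (Finset.mem_sdiff.1 hh).1
  · ext F
    simp only [indepSets, Finset.mem_filter, Finset.mem_powerset]
    refine and_congr_right fun hF => ?_
    have hF' := Finset.insert_subset_insert e₀ hF
    have he : e₀ ∉ F := fun hh => h (hF hh)
    rw [nonactive_insert hmax h0 hF', nonactive_insert_insert hmax φ hφ ha',
      Finset.insert_subset_insert_iff (t := nonactive K a' T F) he]
    have : insert e₀ (nonactive K a' T F) \ insert e₀ F = nonactive K a' T F \ F := by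
      ext x
      simp only [Finset.mem_sdiff, Finset.mem_insert]
      have : x = e₀ → x ∉ nonactive K a' T F := by rintro rfl; exact hn _ _
      tauto
    rw [this]
    tauto

end Count

variable {K σ E : Type*} [Field K] [Infinite K] [Fintype σ] [LinearOrder E]

/-- Both sides satisfy the same recursion on removing the largest element. The induction runs over
all `a` and `κ`, because contraction changes the first and deletion the second. -/
theorem finrank_prodSpan (a : E → σ → K) (T : Finset E) (κ : Set ℕ) :
    Module.finrank K (prodSpan a T κ) = (indepSets K a T κ).card := by
  classical
  induction T using Finset.induction_on_max generalizing a κ with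
  | empty =>
    by_cases h0 : 0 ∈ κ
    · have h1 : prodSpan a ∅ κ = Submodule.span K {1} := by
        rw [prodSpan]
        congr 1
        ext f
        simp only [Finset.subset_empty, Set.mem_image, Set.mem_ofPred_eq, Set.mem_singleton_iff]
        constructor
        · rintro ⟨S, ⟨rfl, _⟩, rfl⟩; simp
        · rintro rfl; exact ⟨∅, ⟨rfl, by simpa using h0⟩, by simp⟩
      rw [h1, finrank_span_singleton one_ne_zero]
      simp [indepSets, nonactive, h0, Finset.filter_singleton]
    · have h1 : prodSpan a ∅ κ = ⊥ := by
        rw [prodSpan, Submodule.span_eq_bot]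
        rintro _ ⟨S, ⟨hS, hSκ⟩, rfl⟩
        rw [Finset.subset_empty] at hS
        subst hS
        exact absurd hSκ (by simpa using h0)
      rw [h1, finrank_bot]
      simp [indepSets, nonactive, h0]
  | insert e₀ T hmax ih =>
    have he₀ : e₀ ∉ T := fun h => lt_irrefl _ (hmax _ h)
    by_cases h0 : a e₀ = 0
    · suffices h : prodSpan a (insert e₀ T) κ = prodSpan a T κ by
        rw [card_indepSets_of_zero he₀ h0, ← ih, h]
      refine le_antisymm (Submodule.span_le.2 ?_) (prodSpan_mono (Finset.subset_insert _ _) _)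
      rintro _ ⟨S, ⟨hS, hSκ⟩, rfl⟩
      by_cases he : e₀ ∈ S
      · have : ∏ e ∈ S, linForm (a e) = 0 :=
          Finset.prod_eq_zero he (by simp [h0, linForm])
        simp [this]
      · exact Submodule.subset_span ⟨S, ⟨(Finset.subset_insert_iff_of_notMem he).1 hS, hSκ⟩, rfl⟩
    · obtain ⟨u, hu⟩ := exists_dotProduct_eq_one h0
      rw [finrank_prodSpan_insert he₀ hu, ih, ih]
      -- The projection along `a e₀` to the vectors orthogonal to `u`; its kernel is the line of `a
      -- e₀`.
      let ℓ : (σ → K) →ₗ[K] K := (dotProductBilin K K).flip u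
      let φ : (σ → K) →ₗ[K] (σ → K) := LinearMap.id - ℓ.smulRight (a e₀)
      have hφ : ∀ b, φ b = b - (b ⬝ᵥ u) • a e₀ := fun b => rfl
      refine (card_indepSets_of_ne_zero hmax h0 φ ?_ fun e => (hφ _).symm).symm
      ext b
      rw [LinearMap.mem_ker, hφ, sub_eq_zero, Submodule.mem_span_singleton]
      constructor
      · exact fun h => ⟨_, h.symm⟩
      · rintro ⟨c, rfl⟩
        rw [smul_dotProduct, hu, smul_eq_mul, mul_one]

end PowerIdeal

/-! ### Duality between relations and products of linear forms. -/

namespace PowerIdeal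

open MvPolynomial

section Rank

variable {K M N I : Type*} [Field K] [AddCommGroup M] [Module K M] [AddCommGroup N] [Module K N]

/-- The rank of a matrix of values `b f (v i)` of a pairing without right kernel is the dimension
of the span of the `v i`. -/
lemma finrank_quotient_ker_pairing [Finite I] (b : M →ₗ[K] N →ₗ[K] K)
    (hb : ∀ g, (∀ f, b f g = 0) → g = 0) (v : I → N) (U : Submodule K M)
    (hU : ∀ f, f ∈ U ↔ ∀ i, b f (v i) = 0) :
    Module.Finite K (M ⧸ U) ∧
      Module.finrank K (M ⧸ U) = Module.finrank K (Submodule.span K (Set.range v)) := by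
  set W := Submodule.span K (Set.range v)
  have : FiniteDimensional K W := FiniteDimensional.span_of_finite K (Set.finite_range v)
  let L : M →ₗ[K] Module.Dual K W := W.subtype.dualMap.comp b
  have hker : LinearMap.ker L = U := by
    ext f
    rw [hU, LinearMap.mem_ker]
    constructor
    · intro h i
      exact DFunLike.congr_fun h (⟨v i, Submodule.subset_span ⟨i, rfl⟩⟩ : W)
    · intro h
      ext ⟨g, hg⟩
      have : W ≤ LinearMap.ker (b f) := by
        rw [Submodule.span_le]
        rintro _ ⟨i, rfl⟩
        exact h i
      exact this hg
  -- The functionals in the range separate the points of the finite-dimensional space `W`, so they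
  -- exhaust its dual.
  have hrange : LinearMap.range L = ⊤ := by
    have h1 : (LinearMap.range L).dualCoannihilator = ⊥ := by
      rw [eq_bot_iff]
      intro g hg
      rw [Submodule.mem_dualCoannihilator] at hg
      rw [Submodule.mem_bot]
      exact Subtype.ext (hb g fun f => hg _ ⟨f, rfl⟩)
    rw [← Subspace.dualCoannihilator_dualAnnihilator_eq (W := LinearMap.range L), h1,
      Submodule.dualAnnihilator_bot]
  rw [← hker]
  refine ⟨Module.Finite.equiv L.quotKerEquivRange.symm, ?_⟩
  rw [L.quotKerEquivRange.finrank_eq, hrange, finrank_top, Subspace.dual_finrank_eq]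

end Rank

section Pairing

variable {K σ E : Type*} [Field K]

/-- The pairing `f(∂) g` at `0` of two polynomials. -/
noncomputable def pairing (K σ : Type*) [Field K] [Fintype σ] :
    MvPolynomial σ K →ₗ[K] MvPolynomial σ K →ₗ[K] K :=
  (basisMonomials σ K).constr K fun m => (∏ i, ((m i).factorial : K)) • lcoeff K m

variable [Fintype σ]

lemma pairing_monomial (m : σ →₀ ℕ) (g : MvPolynomial σ K) :
    pairing K σ (monomial m 1) g = (∏ i, ((m i).factorial : K)) * coeff m g := by
  have : (monomial m 1 : MvPolynomial σ K) = basisMonomials σ K m := by rw [coe_basisMonomials]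
  rw [this, pairing, Module.Basis.constr_basis]
  rfl

lemma eq_zero_of_pairing [CharZero K] (g : MvPolynomial σ K) (h : ∀ f, pairing K σ f g = 0) :
    g = 0 := by
  ext m
  have := h (monomial m 1)
  rw [pairing_monomial] at this
  refine (mul_eq_zero.1 this).resolve_left ?_
  exact Finset.prod_ne_zero_iff.2 fun i _ => Nat.cast_ne_zero.2 (Nat.factorial_ne_zero _)

lemma pairing_C (c : K) (g : MvPolynomial σ K) : pairing K σ (C c) g = c * coeff 0 g := by
  have : (C c : MvPolynomial σ K) = c • monomial 0 1 := by
    rw [smul_monomial, smul_eq_mul, mul_one]; rfl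
  rw [this, map_smul, LinearMap.smul_apply, pairing_monomial]
  simp

/-- Multiplication by a variable is adjoint to the corresponding partial derivative. -/
lemma pairing_mul_X (f g : MvPolynomial σ K) (v : σ) :
    pairing K σ (f * X v) g = pairing K σ f (pderiv v g) := by
  classical
  induction f using MvPolynomial.induction_on' with
  | add p q hp hq => simp only [add_mul, map_add, LinearMap.add_apply, hp, hq]
  | monomial m c =>
    have h1 : (monomial m c : MvPolynomial σ K) = c • monomial m 1 := by
      rw [smul_monomial, smul_eq_mul, mul_one]
    have h2 : (monomial m 1 : MvPolynomial σ K) * X v = monomial (m + Finsupp.single v 1) 1 := by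
      rw [X, monomial_mul, mul_one]
    rw [h1, smul_mul_assoc, h2, map_smul, map_smul, LinearMap.smul_apply, LinearMap.smul_apply,
      pairing_monomial, pairing_monomial, coeff_pderiv]
    congr 1
    have h3 : ∀ i, ((((m + Finsupp.single v 1 : σ →₀ ℕ) i).factorial : ℕ) : K) =
        ((m i).factorial : K) * if i = v then (m i + 1 : K) else 1 := by
      intro i
      by_cases h : i = v
      · subst h
        simp [Nat.factorial_succ, mul_comm]
      · simp [h]
    rw [Finset.prod_congr rfl fun i _ => h3 i, Finset.prod_mul_distrib, Finset.prod_ite_eq',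
      if_pos (Finset.mem_univ _)]
    ring

lemma coeff_zero_prod_linForm (a : E → σ → K) (S : Finset E) [Decidable (S = ∅)] :
    coeff 0 (∏ e ∈ S, linForm (a e)) = if S = ∅ then 1 else 0 := by
  have h : ∀ b : σ → K, constantCoeff (linForm b) = 0 := by
    intro b; simp [linForm]
  rw [← constantCoeff_eq, map_prod]
  split_ifs with h0
  · simp [h0]
  · obtain ⟨e, he⟩ := Finset.nonempty_iff_ne_empty.2 h0
    exact Finset.prod_eq_zero he (h _)

lemma pderiv_prod_linForm [DecidableEq E] (a : E → σ → K) (S : Finset E) (v : σ) :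
    pderiv v (∏ e ∈ S, linForm (a e)) =
      ∑ e ∈ S, C (a e v) * ∏ f ∈ S.erase e, linForm (a f) := by
  classical
  have h : ∀ b : σ → K, pderiv v (linForm b) = C (b v) := by
    intro b
    simp [linForm, pderiv_X, Pi.single_apply]
  induction S using Finset.induction_on with
  | empty => simp
  | insert e₀ S he₀ ih =>
    rw [Finset.prod_insert he₀, pderiv_mul, h, ih, Finset.sum_insert he₀,
      Finset.erase_insert he₀, Finset.mul_sum]
    congr 1
    refine Finset.sum_congr rfl fun e he => ?_
    have h1 : e ≠ e₀ := by rintro rfl; exact he₀ he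
    rw [Finset.erase_insert_of_ne h1.symm,
      Finset.prod_insert fun h => he₀ (Finset.mem_of_mem_erase h)]
    ring

end Pairing

/-! ### Square-free coefficients and the kernel of the substitution. -/

section SquareFree

variable {K σ E : Type*} [Field K] [Fintype E]

open Classical in
/-- The exponent of the square-free monomial `∏ e ∈ S, x_e`. -/
noncomputable def indicatorExponent (S : Finset E) : E →₀ ℕ :=
  Finsupp.equivFunOnFinite.symm fun e => if e ∈ S then 1 else 0

open Classical in
lemma indicatorExponent_apply (S : Finset E) (e : E) :
    indicatorExponent S e = if e ∈ S then 1 else 0 := by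
  simp [indicatorExponent]

lemma degree_indicatorExponent (S : Finset E) : (indicatorExponent S).degree = S.card := by
  classical
  rw [Finsupp.degree_eq_sum]
  simp [indicatorExponent_apply]

/-- The ideal generated by the squares of the variables. -/
noncomputable abbrev squareIdeal (K E : Type*) [CommRing K] : Ideal (MvPolynomial E K) :=
  Ideal.span (Set.range fun e : E => (X e : MvPolynomial E K) ^ 2)

/-- The ideal is monomial, and the monomials divisible by no square are exactly the square-free
ones. -/
lemma mem_squareIdeal_iff (p : MvPolynomial E K) :
    p ∈ squareIdeal K E ↔ ∀ S, coeff (indicatorExponent S) p = 0 := by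
  classical
  have h1 : squareIdeal K E = Ideal.span ((fun s => monomial s (1 : K)) ''
      Set.range fun e : E => Finsupp.single e 2) := by
    rw [squareIdeal, ← Set.range_comp]
    congr 2
    ext1 e
    simp [X_pow_eq_monomial]
  rw [h1, mem_ideal_span_monomial_image]
  constructor
  · intro h S
    by_contra hS
    obtain ⟨_, ⟨e, rfl⟩, he⟩ := h _ (mem_support_iff.2 hS)
    have := he e
    rw [Finsupp.single_eq_same, indicatorExponent_apply] at this
    split_ifs at this <;> omega
  · intro h m hm
    by_contra! hc
    have h2 : ∀ e, m e ≤ 1 := by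
      intro e
      have := hc _ ⟨e, rfl⟩
      rw [Finsupp.single_le_iff] at this
      omega
    have h3 : m = indicatorExponent m.support := by
      ext e
      rw [indicatorExponent_apply]
      have := h2 e
      by_cases h4 : m e = 0
      · simp [h4]
      · rw [if_pos (Finsupp.mem_support_iff.2 h4)]; omega
    exact mem_support_iff.1 hm (h3 ▸ h m.support)

/-- The substitution of the linear forms `∑ e, a e v • x_e` for the variables. -/
noncomputable def flowEval (a : E → σ → K) : MvPolynomial σ K →ₐ[K] MvPolynomial E K :=
  aeval fun v => ∑ e, C (a e v) * X e

/-- Multiplying `f` by `X v` gives the same recursion on both sides: the square-free monomial of `S`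
arises from that of `S.erase e` with coefficient `a e v`, and the Leibniz rule for `∏ e ∈ S, linForm
(a e)` has the same terms. -/
lemma coeff_flowEval [Fintype σ] (a : E → σ → K) (f : MvPolynomial σ K) (S : Finset E) :
    coeff (indicatorExponent S) (flowEval a f) = pairing K σ f (∏ e ∈ S, linForm (a e)) := by
  classical
  induction f using MvPolynomial.induction_on generalizing S with
  | C c =>
    rw [pairing_C, coeff_zero_prod_linForm, flowEval, algHom_C, MvPolynomial.algebraMap_eq,
      coeff_C]
    have : 0 = indicatorExponent S ↔ S = ∅ := by
      constructor
      · intro h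
        ext e
        have := DFunLike.congr_fun h e
        rw [indicatorExponent_apply] at this
        simpa using this
      · rintro rfl
        ext e
        simp [indicatorExponent_apply]
    simp [this]
  | add p q hp hq => simp only [map_add, coeff_add, LinearMap.add_apply, hp, hq]
  | mul_X p v hp =>
    have h1 : flowEval a (X v : MvPolynomial σ K) = ∑ e, C (a e v) * X e := by simp [flowEval]
    rw [map_mul, h1, pairing_mul_X, pderiv_prod_linForm, Finset.mul_sum, coeff_sum, map_sum,
      ← Finset.sum_subset (Finset.subset_univ S)]
    · refine Finset.sum_congr rfl fun e he => ?_
      have h2 : indicatorExponent S = indicatorExponent (S.erase e) + Finsupp.single e 1 := by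
        ext f
        rw [Finsupp.add_apply, indicatorExponent_apply, indicatorExponent_apply,
          Finsupp.single_apply]
        by_cases h : f = e
        · subst h; simp [he]
        · simp [h, Ne.symm h]
      rw [mul_left_comm, coeff_C_mul, h2, coeff_mul_X, hp, ← smul_eq_C_mul, map_smul, smul_eq_mul]
    · intro e _ he
      rw [mul_left_comm, coeff_C_mul, coeff_mul_X', if_neg, mul_zero]
      simp [indicatorExponent_apply, he]

lemma flowEval_isHomogeneous (a : E → σ → K) {f : MvPolynomial σ K} {n : ℕ}
    (hf : f.IsHomogeneous n) : (flowEval a f).IsHomogeneous n := by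
  have := hf.aeval (fun v => ∑ e, C (a e v) * X e) (n := 1) fun v =>
    IsHomogeneous.sum _ _ _ fun e _ => by
      simpa using (isHomogeneous_C E (a e v)).mul (isHomogeneous_X K e)
  rw [one_mul] at this
  exact this

lemma homogeneousComponent_flowEval (a : E → σ → K) (f : MvPolynomial σ K) (n : ℕ) :
    homogeneousComponent n (flowEval a f) = flowEval a (homogeneousComponent n f) := by
  conv_lhs => rw [← sum_homogeneousComponent f]
  rw [map_sum, map_sum]
  rw [Finset.sum_congr rfl fun i _ => homogeneousComponent_of_mem
    (flowEval_isHomogeneous a (homogeneousComponent_isHomogeneous i f))]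
  simp only [Finset.sum_ite_eq, Finset.mem_range]
  split_ifs with h
  · rfl
  · rw [homogeneousComponent_eq_zero _ _ (by omega), map_zero]

lemma homogeneousComponent_mem_squareIdeal {p : MvPolynomial E K} (hp : p ∈ squareIdeal K E)
    (n : ℕ) : homogeneousComponent n p ∈ squareIdeal K E := by
  rw [mem_squareIdeal_iff] at hp ⊢
  intro S
  rw [coeff_homogeneousComponent]
  split_ifs
  exacts [hp S, rfl]

lemma circulationAlgebra_eq_range (a : E → σ → K) :
    circulationAlgebra (Matrix.of fun v e => a e v) =
      ((Ideal.Quotient.mkₐ K (squareIdeal K E)).comp (flowEval a)).range := by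
  have : (Ideal.Quotient.mkₐ K (squareIdeal K E)).comp (flowEval a) =
      aeval fun v => ∑ e, a e v • SquareFreeAlgebra.x K e := by
    ext v
    simp only [flowEval, AlgHom.comp_apply, aeval_X, map_sum, ← smul_eq_C_mul, map_smul]
    rfl
  rw [this, circulationAlgebra, Algebra.adjoin_range_eq_range_aeval]
  rfl

lemma mem_ker_iff (a : E → σ → K) (f : MvPolynomial σ K) :
    (Ideal.Quotient.mkₐ K (squareIdeal K E)) (flowEval a f) = 0 ↔
      ∀ S, coeff (indicatorExponent S) (flowEval a f) = 0 := by
  rw [← mem_squareIdeal_iff]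
  exact Ideal.Quotient.eq_zero_iff_mem

lemma circulationAlgebraPart_eq_range (a : E → σ → K) (k : ℕ) :
    circulationAlgebraPart (Matrix.of fun v e => a e v) k =
      LinearMap.range (((Ideal.Quotient.mkₐ K (squareIdeal K E)).comp
        (flowEval a)).toLinearMap.comp (homogeneousComponent k)) := by
  rw [circulationAlgebraPart, circulationAlgebra_eq_range]
  apply le_antisymm
  · rintro _ ⟨⟨f, rfl⟩, ⟨p, hp, hpf⟩⟩
    refine ⟨f, ?_⟩
    change Ideal.Quotient.mk (squareIdeal K E) p = Ideal.Quotient.mk _ (flowEval a f) at hpf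
    change Ideal.Quotient.mk (squareIdeal K E) (flowEval a (homogeneousComponent k f)) =
      Ideal.Quotient.mk _ (flowEval a f)
    rw [← hpf, Ideal.Quotient.eq, ← homogeneousComponent_flowEval]
    rw [Ideal.Quotient.eq] at hpf
    -- The ideal is homogeneous, so `f` may be replaced by its component of degree `k` without
    -- changing the class.
    have h := homogeneousComponent_mem_squareIdeal hpf k
    rw [map_sub, homogeneousComponent_of_mem hp, if_pos rfl] at h
    rw [← neg_mem_iff, neg_sub]
    exact h
  · rintro _ ⟨f, rfl⟩
    exact ⟨⟨_, rfl⟩, ⟨_, flowEval_isHomogeneous a (homogeneousComponent_isHomogeneous k f), rfl⟩⟩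

variable [Fintype σ] [CharZero K]

/-- The kernel of `φ` is the annihilator of the products with `S.card ∈ κ`. Taking `κ` to be
everything gives the whole algebra, `κ = {k}` its component of degree `k`. -/
lemma finrank_range_eq_prodSpan (a : E → σ → K) {B : Type*} [AddCommGroup B] [Module K B]
    (φ : MvPolynomial σ K →ₗ[K] B) (κ : Set ℕ)
    (hφ : ∀ f, φ f = 0 ↔
      ∀ S : Finset E, S.card ∈ κ → coeff (indicatorExponent S) (flowEval a f) = 0) :
    Module.Finite K (LinearMap.range φ) ∧
    Module.finrank K (LinearMap.range φ) = Module.finrank K (prodSpan a Finset.univ κ) := by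
  have h1 := finrank_quotient_ker_pairing (pairing K σ) eq_zero_of_pairing
    (fun S : {S : Finset E // S.card ∈ κ} => ∏ e ∈ S.1, linForm (a e)) (LinearMap.ker φ) (by
      intro f
      rw [LinearMap.mem_ker, hφ]
      simp only [coeff_flowEval, Subtype.forall])
  have h2 : Set.range (fun S : {S : Finset E // S.card ∈ κ} => ∏ e ∈ S.1, linForm (a e)) =
      (fun S : Finset E => ∏ e ∈ S, linForm (a e)) ''
        {S | S ⊆ Finset.univ ∧ S.card ∈ κ} := by
    ext f
    simp
  rw [h2] at h1
  have := h1.1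
  exact ⟨Module.Finite.equiv φ.quotKerEquivRange, φ.quotKerEquivRange.finrank_eq.symm.trans h1.2⟩

end SquareFree

end PowerIdeal

/-! ### Dimensions of the circulation algebra of a matrix. -/

namespace PowerIdeal

theorem finrank_circulationAlgebra {K V E : Type*} [Field K] [CharZero K] [Fintype V] [Fintype E]
    [LinearOrder E] (a : E → V → K) :
    Module.Finite K (circulationAlgebra (Matrix.of fun v e => a e v)) ∧
    Module.finrank K (circulationAlgebra (Matrix.of fun v e => a e v)) =
      (indepSets K a Finset.univ Set.univ).card ∧
    ∀ k, Module.finrank K (circulationAlgebraPart (Matrix.of fun v e => a e v) k) =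
      (indepSets K a Finset.univ {k}).card := by
  simp only [← finrank_prodSpan]
  rw [← and_assoc]
  constructor
  · rw [circulationAlgebra_eq_range]
    exact finrank_range_eq_prodSpan a
      ((Ideal.Quotient.mkₐ K (squareIdeal K E)).comp (flowEval a)).toLinearMap Set.univ
      fun f => (mem_ker_iff a f).trans (by simp)
  · intro k
    rw [circulationAlgebraPart_eq_range]
    refine (finrank_range_eq_prodSpan a _ {k} fun f => (mem_ker_iff a _).trans ?_).2
    refine forall_congr' fun S => ?_
    rw [← homogeneousComponent_flowEval, MvPolynomial.coeff_homogeneousComponent,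
      degree_indicatorExponent]
    simp

/-- Turns span conditions on columns into the existence of vertex weightings, the form needed for
graphs. -/
lemma notMem_span_iff_exists_dotProduct {K V : Type*} [Field K] [Fintype V]
    {b : V → K} {s : Set (V → K)} :
    b ∉ Submodule.span K s ↔ ∃ f : V → K, b ⬝ᵥ f ≠ 0 ∧ ∀ c ∈ s, c ⬝ᵥ f = 0 := by
  classical
  constructor
  · intro h
    obtain ⟨φ, h1, h2⟩ := Submodule.exists_le_ker_of_notMem h
    have hφ : ∀ c, c ⬝ᵥ (fun i => φ (Pi.single i 1)) = φ c := by
      intro c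
      conv_rhs => rw [LinearMap.pi_apply_eq_sum_univ φ c]
      refine Finset.sum_congr rfl fun i _ => ?_
      rw [smul_eq_mul]
      congr 1
      change φ (Pi.single i 1) = _
      congr 1
      funext j
      simp [Pi.single_apply, eq_comm]
    exact ⟨_, by rwa [hφ], fun c hc => by rw [hφ]; exact h2 (Submodule.subset_span hc)⟩
  · rintro ⟨f, h1, h2⟩ h
    refine h1 ?_
    clear h1
    induction h using Submodule.span_induction with
    | mem c hc => exact h2 c hc
    | zero => exact zero_dotProduct f
    | add x y _ _ hx hy => rw [add_dotProduct, hx, hy, add_zero]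
    | smul c x _ hx => rw [smul_dotProduct, hx, smul_zero]

end PowerIdeal

/-! ### Even circuits, pseudoforests and edge equations. -/

namespace Graph

variable {α β : Type*} {G H C D : Graph α β}

/-! ### Cycles indexed by natural numbers -/

lemma exists_le_of_sets {X : Set α} {F : Set β} (hX : X ⊆ V(G))
    (hF : ∀ e ∈ F, ∃ x ∈ X, ∃ y ∈ X, G.IsLink e x y) : ∃ D ≤ G, V(D) = X ∧ E(D) = F := by
  refine ⟨(G.restrict F).induce X, ?_, rfl, ?_⟩
  · exact (induce_le (G := G.restrict F) hX).trans restrict_le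
  · ext e
    rw [edgeSet_induce]
    constructor
    · rintro ⟨x, y, h, _⟩
      exact h.1
    · intro he
      obtain ⟨x, hx, y, hy, h⟩ := hF e he
      exact ⟨x, y, ⟨he, h⟩, hx, hy⟩

/-- The vertices and edges of a cycle as periodic sequences starting at a given vertex. -/
lemma IsCycleOfLength.exists_periodic {n : ℕ} (hC : C.IsCycleOfLength n) {x : α} (hx : x ∈ V(C)) :
    ∃ (v : ℕ → α) (e : ℕ → β), v 0 = x ∧ v n = x ∧ (∀ i, C.IsLink (e i) (v i) (v (i + 1))) ∧
      ∀ s, (∀ i < n, ∀ j < n, v (s + i) = v (s + j) → i = j) ∧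
        (∀ i < n, ∀ j < n, e (s + i) = e (s + j) → i = j) ∧
        (∀ y ∈ V(C), ∃ i < n, v (s + i) = y) ∧ ∀ d ∈ E(C), ∃ i < n, e (s + i) = d := by
  obtain ⟨hn, v, e, hv, he, hV, hE, hl⟩ := hC
  have : NeZero n := ⟨hn.ne'⟩
  rw [hV] at hx
  obtain ⟨i₀, rfl⟩ := hx
  have hcast : ∀ s i : ℕ, i < n → ∀ j < n,
      (i₀ + ((s + i : ℕ) : ZMod n)) = i₀ + ((s + j : ℕ) : ZMod n) → i = j := by
    intro s i hi j hj h
    push_cast at h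
    have := congrArg ZMod.val (add_left_cancel (add_left_cancel h))
    rwa [ZMod.val_cast_of_lt hi, ZMod.val_cast_of_lt hj] at this
  have hsurj : ∀ (s : ℕ) (k : ZMod n), ∃ i < n, i₀ + ((s + i : ℕ) : ZMod n) = k := fun s k =>
    ⟨(k - i₀ - s).val, ZMod.val_lt _, by push_cast; rw [ZMod.natCast_zmod_val]; ring⟩
  refine ⟨fun i => v (i₀ + i), fun i => e (i₀ + i), by simp, by simp, ?_, fun s => ⟨?_, ?_, ?_, ?_⟩⟩
  · intro i
    have := hl (i₀ + i)
    rwa [add_assoc, ← Nat.cast_succ] at this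
  · exact fun i hi j hj h => hcast s i hi j hj (hv h)
  · exact fun i hi j hj h => hcast s i hi j hj (he h)
  · rw [hV]
    rintro _ ⟨k, rfl⟩
    obtain ⟨i, hi, rfl⟩ := hsurj s k
    exact ⟨i, hi, rfl⟩
  · rw [hE]
    rintro _ ⟨k, rfl⟩
    obtain ⟨i, hi, rfl⟩ := hsurj s k
    exact ⟨i, hi, rfl⟩

lemma isCycleOfLength_of_nat {n : ℕ} (hn : 0 < n) {v : ℕ → α} {e : ℕ → β} (hvn : v n = v 0)
    (hl : ∀ i < n, C.IsLink (e i) (v i) (v (i + 1)))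
    (hv : ∀ i < n, ∀ j < n, v i = v j → i = j) (he : ∀ i < n, ∀ j < n, e i = e j → i = j)
    (hV : V(C) = v '' Set.Iio n) (hE : E(C) = e '' Set.Iio n) : C.IsCycleOfLength n := by
  have : NeZero n := ⟨hn.ne'⟩
  refine ⟨hn, fun i => v i.val, fun i => e i.val, ?_, ?_, ?_, ?_, ?_⟩
  · exact fun i j h => ZMod.val_injective n (hv _ (ZMod.val_lt i) _ (ZMod.val_lt j) h)
  · exact fun i j h => ZMod.val_injective n (he _ (ZMod.val_lt i) _ (ZMod.val_lt j) h)
  · rw [hV]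
    ext y
    constructor
    · rintro ⟨i, hi, rfl⟩
      exact ⟨(i : ZMod n), by simp only [ZMod.val_cast_of_lt hi]⟩
    · rintro ⟨i, rfl⟩
      exact ⟨i.val, ZMod.val_lt i, rfl⟩
  · rw [hE]
    ext y
    constructor
    · rintro ⟨i, hi, rfl⟩
      exact ⟨(i : ZMod n), by simp only [ZMod.val_cast_of_lt hi]⟩
    · rintro ⟨i, rfl⟩
      exact ⟨i.val, ZMod.val_lt i, rfl⟩
  · intro i
    have h1 := hl i.val (ZMod.val_lt i)
    have h2 : v (i + 1).val = v (i.val + 1) := by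
      rw [ZMod.val_add, ZMod.val_one_eq_one_mod, Nat.add_mod_mod]
      rcases Nat.lt_or_ge (i.val + 1) n with h | h
      · rw [Nat.mod_eq_of_lt h]
      · have h3 : i.val + 1 = n := le_antisymm (ZMod.val_lt i) h
        rw [h3, Nat.mod_self, hvn]
    rw [← h2] at h1
    exact h1

lemma exists_cycle_of_nat {n : ℕ} (hn : 0 < n) {v : ℕ → α} {e : ℕ → β} (hvn : v n = v 0)
    (hl : ∀ i < n, G.IsLink (e i) (v i) (v (i + 1)))
    (hv : ∀ i < n, ∀ j < n, v i = v j → i = j) (he : ∀ i < n, ∀ j < n, e i = e j → i = j) :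
    ∃ C ≤ G, C.IsCycleOfLength n ∧ V(C) = v '' Set.Iio n ∧ E(C) = e '' Set.Iio n := by
  have hmem : ∀ i ≤ n, v i ∈ v '' Set.Iio n := by
    intro i hi
    rcases hi.lt_or_eq with h | rfl
    · exact ⟨i, h, rfl⟩
    · exact ⟨0, hn, hvn.symm⟩
  obtain ⟨C, hC, hV, hE⟩ := exists_le_of_sets (G := G) (X := v '' Set.Iio n) (F := e '' Set.Iio n)
    (by rintro _ ⟨i, hi, rfl⟩; exact (hl i hi).left_mem)
    (by
      rintro _ ⟨i, hi, rfl⟩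
      exact ⟨_, hmem i (le_of_lt hi), _, hmem (i + 1) hi, hl i hi⟩)
  refine ⟨C, hC, isCycleOfLength_of_nat hn hvn (fun i hi => ?_) hv he hV hE, hV, hE⟩
  exact (hC.isLink_iff (by rw [hE]; exact ⟨i, hi, rfl⟩)).2 (hl i hi)

lemma IsCycleOfLength.eq_of_loop {n : ℕ} (hC : C.IsCycleOfLength n) {e : β} {x : α}
    (h : C.IsLink e x x) : n = 1 ∧ V(C) = {x} ∧ E(C) = {e} := by
  obtain ⟨hn, v, e', hv, he, hV, hE, hl⟩ := hC
  obtain ⟨i, rfl⟩ : e ∈ Set.range e' := hE ▸ h.edge_mem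
  have h1 : v i = v (i + 1) := by
    rcases (hl i).eq_and_eq_or_eq_and_eq h with ⟨h1, h2⟩ | ⟨h1, h2⟩ <;> rw [h1, h2]
  have h2 : (1 : ZMod n) = 0 := by simpa using (hv h1).symm
  have h3 : n = 1 := by
    rcases Nat.lt_or_ge 1 n with h | h
    · have : Fact (1 < n) := ⟨h⟩
      exact absurd h2 one_ne_zero
    · omega
  subst h3
  have h4 : x = v i := by
    rcases (hl i).eq_and_eq_or_eq_and_eq h with ⟨h1, h2⟩ | ⟨h1, h2⟩ <;> rw [h1]
  refine ⟨rfl, ?_, ?_⟩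
  · rw [hV, h4]
    ext y
    simp only [Set.mem_range, Set.mem_singleton_iff]
    exact ⟨by rintro ⟨j, rfl⟩; rw [Subsingleton.elim j i], by rintro rfl; exact ⟨i, rfl⟩⟩
  · rw [hE]
    ext y
    simp only [Set.mem_range, Set.mem_singleton_iff]
    exact ⟨by rintro ⟨j, rfl⟩; rw [Subsingleton.elim j i], by rintro rfl; exact ⟨i, rfl⟩⟩

lemma IsCycleOfLength.nonempty {n : ℕ} (hC : C.IsCycleOfLength n) : V(C).Nonempty := by
  obtain ⟨hn, v, e', hv, he, hV, hE, hl⟩ := hC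
  exact ⟨v 0, hV ▸ ⟨0, rfl⟩⟩

/-! ### Solvability of the edge equations -/

/-- Every function on the edges of `H` is the sum over the two ends of a function on the vertices.
For finite graphs in characteristic other than two this means that the columns of the undirected
incidence matrix are linearly independent. -/
def IsSolvable (K : Type*) [Field K] (H : Graph α β) : Prop :=
  ∀ g : β → K, ∃ f : α → K, ∀ e x y, H.IsLink e x y → f x + f y = g e

variable {K : Type*} [Field K]

lemma IsSolvable.mono (h : H.IsSolvable K) (hD : D ≤ H) : D.IsSolvable K := fun g =>
  (h g).imp fun _ hf e x y hl => hf e x y (hl.mono hD)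

lemma alternating {f : α → K} {v : ℕ → α} {n : ℕ} (h : ∀ i < n, f (v i) + f (v (i + 1)) = 0) :
    ∀ i ≤ n, f (v i) = (-1) ^ i * f (v 0) := by
  intro i
  induction i with
  | zero => simp
  | succ i ih =>
    intro hi
    have h1 := h i hi
    rw [ih (by omega)] at h1
    rw [pow_succ]
    linear_combination h1

variable [CharZero K]

/-- Signs alternate along the cycle, so one turn around an odd cycle gives `f x = -f x`. -/
lemma IsOddCycle.eq_zero (hC : C.IsOddCycle) {f : α → K}
    (hf : ∀ e x y, C.IsLink e x y → f x + f y = 0) {x : α} (hx : x ∈ V(C)) : f x = 0 := by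
  obtain ⟨n, hn, hC⟩ := hC
  obtain ⟨v, e, h0, hvn, hl, -⟩ := hC.exists_periodic hx
  have := alternating (f := f) (fun i (_ : i < n) => hf _ _ _ (hl i)) n le_rfl
  rw [hvn, h0, hn.neg_one_pow] at this
  have h2 : (2 : K) * f x = 0 := by linear_combination this
  exact (mul_eq_zero.1 h2).resolve_left two_ne_zero

-- Take `e₀` to be an edge leaving `x`. Values alternate in sign along the other `n - 1` edges,
-- while the two ends of `e₀` sum to `1`: impossible for even `n`, and `2 * f x = 1` for odd `n`.
open Classical in
lemma IsCycleOfLength.exists_edge {n : ℕ} (hC : C.IsCycleOfLength n) {x : α} (hx : x ∈ V(C))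
    (K : Type*) [Field K] [CharZero K] :
    ∃ e₀ y, C.IsLink e₀ x y ∧ ∀ f : α → K,
      (∀ e a b, C.IsLink e a b → f a + f b = if e = e₀ then 1 else 0) → Odd n ∧ f x ≠ 0 := by
  obtain ⟨v, e, h0, hvn, hl, hs⟩ := hC.exists_periodic hx
  refine ⟨e 0, v 1, by simpa [h0] using hl 0, fun f hf => ?_⟩
  have hn := hC.1
  have h1 : f x + f (v 1) = 1 := by simpa [h0] using hf _ _ _ (hl 0)
  have h2 := alternating (f := f) (v := fun i => v (i + 1)) (n := n - 1) (fun i hi => by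
    rw [hf _ _ _ (hl (i + 1)), if_neg]
    intro h
    have := (hs 0).2.1 (i + 1) (by omega) 0 hn (by simpa using h)
    omega) (n - 1) le_rfl
  have h3 : n - 1 + 1 = n := by omega
  simp only [h3, zero_add, hvn] at h2
  rcases Nat.even_or_odd n with h | h
  · have h4 : Odd (n - 1) := by
      rw [← Nat.not_even_iff_odd]
      intro h5
      have := h5.add_one
      rw [h3] at this
      exact (Nat.not_even_iff_odd.2 this) h
    rw [h4.neg_one_pow] at h2
    exfalso
    have : (1 : K) = 0 := by linear_combination h2 - h1
    exact one_ne_zero this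
  · have h4 : Even (n - 1) := by
      rw [← Nat.not_odd_iff_even]
      intro h5
      have := h5.add_one
      rw [h3] at this
      exact (Nat.not_even_iff_odd.2 h) this
    refine ⟨h, fun h5 => ?_⟩
    rw [h4.neg_one_pow, h5] at h2
    rw [h5] at h1
    have : (1 : K) = 0 := by linear_combination - h2 - h1
    exact one_ne_zero this

/-- The right-hand side is the indicator of an edge `e₀` at `x` on a cycle. An even cycle admits no
solution. In the other cases the first cycle forces `f x ≠ 0`, whereas the second forces `f` to
vanish on it, hence at `x`, directly or by propagation along the path. -/
theorem IsEvenCircuit.not_isSolvable (hD : D.IsEvenCircuit) (K : Type*) [Field K] [CharZero K] :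
    ¬ D.IsSolvable K := by
  classical
  intro hS
  rcases hD with ⟨n, hn, hC⟩ | ⟨C₁, h₁, C₂, h₂, ⟨n, hn, hC₁⟩, hC₂, hne, ⟨x, hx⟩, -, -⟩ |
    ⟨C₁, h₁, C₂, h₂, P, hP, x, y, ⟨n, hn, hC₁⟩, hC₂, ⟨m, v, e, hv, hVP, hEP, hv0, hvm, hl⟩,
      hdisj, hx, hy, -, -⟩
  · obtain ⟨x, hx⟩ := hC.nonempty
    obtain ⟨e₀, y, -, h⟩ := hC.exists_edge hx K
    obtain ⟨f, hf⟩ := hS fun e => if e = e₀ then 1 else 0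
    exact (Nat.not_even_iff_odd.2 (h f hf).1) hn
  · have hx' : x ∈ V(C₁) ∩ V(C₂) := hx ▸ rfl
    obtain ⟨e₀, y, he₀, h⟩ := hC₁.exists_edge hx'.1 K
    obtain ⟨f, hf⟩ := hS fun e => if e = e₀ then 1 else 0
    refine (h f fun e a b hl => hf e a b (hl.mono h₁)).2
      (hC₂.eq_zero (fun e a b hl => ?_) hx'.2)
    rw [hf e a b (hl.mono h₂), if_neg]
    -- If `e₀` were also in the second cycle, both its ends would be `x`; a loop is a whole cycle,
    -- so the two cycles would coincide.
    rintro rfl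
    have hl' : C₂.IsLink e x y := (h₂.isLink_iff hl.edge_mem).2 (he₀.mono h₁)
    have hy : y ∈ V(C₁) ∩ V(C₂) := ⟨he₀.right_mem, hl'.right_mem⟩
    rw [hx] at hy
    obtain rfl := Set.mem_singleton_iff.1 hy
    obtain ⟨k, -, hC₂⟩ := hC₂
    obtain ⟨-, hV1, hE1⟩ := hC₁.eq_of_loop he₀
    obtain ⟨-, hV2, hE2⟩ := hC₂.eq_of_loop hl'
    exact hne ((Compatible.of_le_le h₁ h₂).ext (hV1.trans hV2.symm) (hE1.trans hE2.symm))
  · have hx' : x ∈ V(P) ∩ V(C₁) := hx ▸ rfl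
    have hy' : y ∈ V(P) ∩ V(C₂) := hy ▸ rfl
    obtain ⟨e₀, z, he₀, h⟩ := hC₁.exists_edge hx'.2 K
    obtain ⟨f, hf⟩ := hS fun e => if e = e₀ then 1 else 0
    refine (h f fun e a b hl => hf e a b (hl.mono h₁)).2 ?_
    have hfy : f y = 0 := by
      refine hC₂.eq_zero (fun e a b hl => ?_) hy'.2
      rw [hf e a b (hl.mono h₂), if_neg]
      rintro rfl
      have hl' : C₂.IsLink e x z := (h₂.isLink_iff hl.edge_mem).2 (he₀.mono h₁)
      exact Set.disjoint_left.1 hdisj hx'.2 hl'.left_mem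
    have hall : ∀ i, f (v i) = 0 := by
      intro i
      induction i using Fin.reverseInduction with
      | last => rw [hvm, hfy]
      | cast i ih =>
        have h3 := hf _ _ _ ((hl i).mono hP)
        rw [ih, add_zero, if_neg] at h3
        · exact h3
        -- If `e₀` were on the path, its ends would both be `x`, contradicting the injectivity of
        -- the path.
        · intro h4
          have hl' : P.IsLink e₀ x z :=
            (hP.isLink_iff (h4 ▸ (hl i).edge_mem)).2 (he₀.mono h₁)
          have hz : z ∈ V(P) ∩ V(C₁) := ⟨hl'.right_mem, he₀.right_mem⟩
          rw [hx] at hz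
          obtain rfl := Set.mem_singleton_iff.1 hz
          have h5 := hl i
          rw [h4] at h5
          have h6 : v i.castSucc = v i.succ := by
            rcases h5.eq_and_eq_or_eq_and_eq hl' with ⟨h1, h2⟩ | ⟨h1, h2⟩ <;> rw [h1, h2]
          exact (Fin.castSucc_lt_succ (i := i)).ne (hv h6)
    rw [← hv0]
    exact hall 0

end Graph

namespace Graph

variable {α β : Type*} {G H C D : Graph α β}

/-! ### Shortest paths -/

lemma exists_nat_walk [Nonempty β] {x y : α} (h : Relation.ReflTransGen H.Adj x y) :
    ∃ (n : ℕ) (v : ℕ → α) (e : ℕ → β), v 0 = x ∧ v n = y ∧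
      ∀ i < n, H.IsLink (e i) (v i) (v (i + 1)) := by
  induction h with
  | refl => exact ⟨0, fun _ => x, fun _ => Classical.arbitrary β, rfl, rfl, by simp⟩
  | @tail y z _ hyz ih =>
    obtain ⟨n, v, e, h0, hn, hl⟩ := ih
    obtain ⟨e', he'⟩ := hyz
    refine ⟨n + 1, fun i => if i ≤ n then v i else z, fun i => if i < n then e i else e',
      by simpa using h0, by simp, fun i hi => ?_⟩
    rcases Nat.lt_or_ge i n with h | h
    · simpa [h, h.le] using hl i h
    · obtain rfl : i = n := by omega
      simpa [hn] using he'

/-- A shortest walk between two sets of vertices is a path that meets them only in its ends. -/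
lemma exists_shortest_path [Nonempty β] {A B : Set α} {x y : α} (hx : x ∈ A) (hy : y ∈ B)
    (h : Relation.ReflTransGen H.Adj x y) :
    ∃ (n : ℕ) (v : ℕ → α) (e : ℕ → β), v 0 ∈ A ∧ v n ∈ B ∧
      (∀ i < n, H.IsLink (e i) (v i) (v (i + 1))) ∧
      (∀ i ≤ n, ∀ j ≤ n, v i = v j → i = j) ∧
      (∀ i ≤ n, v i ∈ A → i = 0) ∧ (∀ i ≤ n, v i ∈ B → i = n) := by
  classical
  have hex : ∃ n : ℕ, ∃ (v : ℕ → α) (e : ℕ → β), v 0 ∈ A ∧ v n ∈ B ∧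
      ∀ i < n, H.IsLink (e i) (v i) (v (i + 1)) := by
    obtain ⟨n, v, e, rfl, rfl, hl⟩ := exists_nat_walk h
    exact ⟨n, v, e, hx, hy, hl⟩
  obtain ⟨v, e, h0, hn, hl⟩ := Nat.find_spec hex
  have hmin := fun m => Nat.find_min' hex (m := m)
  generalize Nat.find hex = n at *
  refine ⟨n, v, e, h0, hn, hl, ?_, ?_, ?_⟩
  · have key : ∀ i j, i < j → j ≤ n → v i ≠ v j := by
      intro i j hij hj hv
      -- Cutting out the stretch between two visits to the same vertex gives a shorter walk.
      have := hmin (n - (j - i)) ⟨fun k => if k ≤ i then v k else v (k + (j - i)),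
        fun k => if k < i then e k else e (k + (j - i)), by simpa using h0, ?_, fun k hk => ?_⟩
      · omega
      · dsimp only
        split_ifs with h1
        · obtain rfl : j = n := by omega
          rw [show j - (j - i) = i by omega, hv]
          exact hn
        · rwa [Nat.sub_add_cancel (by omega)]
      · rcases lt_trichotomy k i with h1 | h1 | h1
        · simpa [h1, h1.le, Nat.succ_le_of_lt h1] using hl k (by omega)
        · subst h1
          have := hl j (by omega)
          rw [← hv] at this
          simp only [le_refl, if_true, lt_irrefl, if_false, Nat.not_succ_le_self]
          rwa [show k + (j - k) = j by omega, show k + 1 + (j - k) = j + 1 by omega]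
        · have := hl (k + (j - i)) (by omega)
          simp only [h1.not_ge, h1.not_gt, if_false, show ¬ (k + 1 ≤ i) by omega]
          rwa [show k + 1 + (j - i) = k + (j - i) + 1 by omega]
    intro i hi j hj hv
    rcases lt_trichotomy i j with h1 | h1 | h1
    · exact absurd hv (key i j h1 hj)
    · exact h1
    · exact absurd hv.symm (key j i h1 hi)
  · intro i hi hA
    have := hmin (n - i) ⟨fun k => v (k + i), fun k => e (k + i), by simpa using hA,
      by simpa [Nat.sub_add_cancel hi] using hn, fun k hk => by
        have := hl (k + i) (by omega)
        rwa [show k + i + 1 = k + 1 + i by omega] at this⟩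
    omega
  · intro i hi hB
    have := hmin i ⟨v, e, h0, hB, fun k hk => hl k (by omega)⟩
    omega

lemma path_edge_injective {n : ℕ} {v : ℕ → α} {e : ℕ → β}
    (hl : ∀ i < n, H.IsLink (e i) (v i) (v (i + 1)))
    (hv : ∀ i ≤ n, ∀ j ≤ n, v i = v j → i = j) : ∀ i < n, ∀ j < n, e i = e j → i = j := by
  intro i hi j hj h
  have h1 := hl i hi
  rw [h] at h1
  rcases h1.eq_and_eq_or_eq_and_eq (hl j hj) with ⟨h2, -⟩ | ⟨h2, h3⟩
  · exact hv _ hi.le _ hj.le h2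
  · have h4 := hv _ hi.le _ hj h2
    have h5 := hv _ hi _ hj.le h3
    omega

/-! ### Acyclic graphs -/

/-- A shortest path avoiding `e` between its ends is closed up by `e`. -/
lemma exists_isCycle_of_reachable {e : β} {x y : α} (he : H.IsLink e x y)
    (h : Relation.ReflTransGen (H.deleteEdges {e}).Adj y x) : ∃ C ≤ H, C.IsCycle := by
  have : Nonempty β := ⟨e⟩
  obtain ⟨n, v, e', rfl, rfl, hl, hv, -⟩ :=
    exists_shortest_path (A := {y}) (B := {x}) rfl rfl h
  have hl' : ∀ i < n, H.IsLink (e' i) (v i) (v (i + 1)) ∧ e' i ≠ e := fun i hi => by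
    simpa using hl i hi
  obtain ⟨C, hC, hCn, -⟩ := exists_cycle_of_nat (G := H) (n := n + 1) (Nat.succ_pos n)
    (v := fun i => if i ≤ n then v i else v 0) (e := fun i => if i < n then e' i else e)
    (by simp) (fun i hi => by
      rcases Nat.lt_or_ge i n with h | h
      · simpa [h, h.le] using (hl' i h).1
      · obtain rfl : i = n := by omega
        simpa using he)
    (fun i hi j hj h => by
      rw [if_pos (by omega), if_pos (by omega)] at h
      exact hv i (by omega) j (by omega) h)
    (fun i hi j hj h => by
      split_ifs at h with h1 h2 h2
      · exact path_edge_injective hl hv i h1 j h2 h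
      · exact absurd h (hl' i h1).2
      · exact absurd h.symm (hl' j h2).2
      · omega)
  exact ⟨C, hC, _, hCn⟩

/-- An acyclic graph with a vertex has fewer edges than vertices. -/
lemma ncard_edgeSet_lt_of_acyclic [Finite V(H)] [Finite E(H)] (hne : V(H).Nonempty)
    (h : ∀ C ≤ H, ¬ C.IsCycle) : E(H).ncard < V(H).ncard := by
  classical
  have := Fintype.ofFinite V(H)
  have := Fintype.ofFinite E(H)
  choose t s hts using fun e : E(H) => exists_isLink_of_mem_edgeSet e.2
  let φ : (V(H) → ℚ) →ₗ[ℚ] (E(H) → ℚ) := LinearMap.pi fun e =>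
    LinearMap.proj ⟨t e, (hts e).left_mem⟩ - LinearMap.proj ⟨s e, (hts e).right_mem⟩
  have hφ : ∀ f e, φ f e = f ⟨t e, (hts e).left_mem⟩ - f ⟨s e, (hts e).right_mem⟩ :=
    fun f e => rfl
  -- The indicator of the component of `t e` in `H` without `e` has difference zero on all other
  -- edges. By acyclicity `s e` lies outside that component.
  have hsingle : ∀ e, Pi.single e 1 ∈ LinearMap.range φ := by
    intro e
    refine ⟨fun v => if Relation.ReflTransGen (H.deleteEdges {e.1}).Adj (t e) v then 1 else 0, ?_⟩
    ext e'
    rw [hφ]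
    dsimp only
    by_cases hee : e' = e
    · subst hee
      rw [Pi.single_eq_same, if_pos Relation.ReflTransGen.refl, if_neg, sub_zero]
      intro hr
      obtain ⟨C, hC, hC'⟩ := exists_isCycle_of_reachable (hts e').symm hr
      exact h C hC hC'
    · rw [Pi.single_eq_of_ne hee, sub_eq_zero]
      have hadj : (H.deleteEdges {e.1}).Adj (t e') (s e') :=
        ⟨e', by simpa using ⟨hts e', fun h => hee (Subtype.ext h)⟩⟩
      congr 1
      exact propext ⟨fun h => h.tail hadj, fun h => h.tail hadj.symm⟩
  have hrange : LinearMap.range φ = ⊤ := by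
    rw [eq_top_iff]
    rintro g -
    rw [pi_eq_sum_univ' g]
    exact Submodule.sum_mem _ fun e _ => Submodule.smul_mem _ _ (by
      convert hsingle e using 1)
  -- Constants have zero difference, so the rank `|E|` is less than `|V|`.
  have hker : 0 < Module.finrank ℚ (LinearMap.ker φ) := by
    rw [Module.finrank_pos_iff_exists_ne_zero]
    refine ⟨⟨fun _ => 1, ?_⟩, ?_⟩
    · ext e
      rw [hφ]
      simp
    · obtain ⟨x, hx⟩ := hne
      intro h0
      have := congrFun (congrArg Subtype.val h0) ⟨x, hx⟩
      simp at this
  have := φ.finrank_range_add_finrank_ker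
  rw [hrange, finrank_top, Module.finrank_fintype_fun_eq_card,
    Module.finrank_fintype_fun_eq_card] at this
  rw [← Nat.card_coe_set_eq, ← Nat.card_coe_set_eq, Nat.card_eq_fintype_card,
    Nat.card_eq_fintype_card]
  omega

/-! ### Components -/

/-- The component of a vertex. -/
noncomputable def componentOf (H : Graph α β) (x : α) : Graph α β :=
  H.induce {y | Relation.ReflTransGen H.Adj x y}

lemma reflTransGen_symm {x y : α} (h : Relation.ReflTransGen H.Adj x y) :
    Relation.ReflTransGen H.Adj y x := by
  induction h with
  | refl => exact .refl
  | tail _ h ih => exact .head h.symm ih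

lemma componentOf_eq {x y : α} (h : Relation.ReflTransGen H.Adj x y) :
    H.componentOf x = H.componentOf y := by
  rw [componentOf, componentOf]
  congr 1
  ext z
  exact ⟨fun hz => (reflTransGen_symm h).trans hz, fun hz => h.trans hz⟩

lemma mem_of_reachable {x y : α} (hx : x ∈ V(H)) (h : Relation.ReflTransGen H.Adj x y) :
    y ∈ V(H) := by
  rcases Relation.ReflTransGen.cases_tail h with rfl | ⟨z, -, h⟩
  exacts [hx, h.right_mem]

lemma isComponent_componentOf {x : α} (hx : x ∈ V(H)) : H.IsComponent (H.componentOf x) := by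
  have hV : V(H.componentOf x) = {y | Relation.ReflTransGen H.Adj x y} := rfl
  have hle : H.componentOf x ≤ H := induce_le fun y hy => mem_of_reachable hx hy
  have hreach : ∀ y, Relation.ReflTransGen H.Adj x y →
      Relation.ReflTransGen (H.componentOf x).Adj x y := by
    intro y h
    induction h with
    | refl => exact .refl
    | @tail y z hxy hyz ih =>
      obtain ⟨e, he⟩ := hyz
      exact ih.tail ⟨e, he, hxy, hxy.tail ⟨e, he⟩⟩
  refine ⟨⟨hle, ⟨x, .refl⟩, fun y hy z hz => ?_⟩, ?_⟩
  · exact (reflTransGen_symm (hreach y hy)).trans (hreach z hz)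
  · rintro H' ⟨hH', -, hc⟩ hge
    have hmem : ∀ y ∈ V(H'), Relation.ReflTransGen H.Adj x y := fun y hy =>
      Relation.ReflTransGen.mono (r := H'.Adj) (fun _ _ h => Adj.mono hH' h) _ _
        (hc x (hge.vertexSet_mono (show x ∈ V(H.componentOf x) from .refl)) y hy)
    exact ⟨hmem, fun e a b hab => ⟨hab.mono hH', hmem _ hab.left_mem, hmem _ hab.right_mem⟩⟩

/-! ### Solvability of pseudoforests -/

variable {K : Type*} [Field K]

lemma IsConnected.eq_zero (hH : H.IsConnected) {f : α → K}
    (hf : ∀ e x y, H.IsLink e x y → f x + f y = 0) {x y : α} (hx : x ∈ V(H)) (hfx : f x = 0)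
    (hy : y ∈ V(H)) : f y = 0 := by
  have := hH.2 x hx y hy
  induction this with
  | refl => exact hfx
  | tail h1 h2 ih =>
    obtain ⟨e, he⟩ := h2
    have := hf _ _ _ he
    rwa [ih he.left_mem, zero_add] at this

-- On a connected graph a homogeneous solution is determined by its value at `x`, so the edge-sum
-- map has nullity at most one, and zero if `f x = 0` is forced. The edge count then makes it
-- surjective.
open Classical in
lemma IsConnected.isSolvable_of_ncard [Finite V(H)] [Finite E(H)] (hH : H.IsConnected) {x : α}
    (hx : x ∈ V(H)) (h : E(H).ncard < V(H).ncard ∨ E(H).ncard ≤ V(H).ncard ∧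
      ∀ f : α → K, (∀ e x y, H.IsLink e x y → f x + f y = 0) → f x = 0) : H.IsSolvable K := by
  have := Fintype.ofFinite V(H)
  have := Fintype.ofFinite E(H)
  choose t s hts using fun e : E(H) => exists_isLink_of_mem_edgeSet e.2
  let φ : (V(H) → K) →ₗ[K] (E(H) → K) := LinearMap.pi fun e =>
    LinearMap.proj ⟨t e, (hts e).left_mem⟩ + LinearMap.proj ⟨s e, (hts e).right_mem⟩
  let ext : (V(H) → K) → α → K := fun f z => if hz : z ∈ V(H) then f ⟨z, hz⟩ else 0
  have hext : ∀ f (z : V(H)), ext f z = f z := fun f z => dif_pos z.2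
  have hφ : ∀ f e x y, (hl : H.IsLink e x y) → ext f x + ext f y = φ f ⟨e, hl.edge_mem⟩ := by
    intro f e x y hl
    have h1 : φ f ⟨e, hl.edge_mem⟩ = ext f (t ⟨e, hl.edge_mem⟩) + ext f (s ⟨e, hl.edge_mem⟩) :=
      congrArg₂ (· + ·) (hext f ⟨_, _⟩).symm (hext f ⟨_, _⟩).symm
    rw [h1]
    rcases hl.eq_and_eq_or_eq_and_eq (hts ⟨e, hl.edge_mem⟩) with ⟨h2, h3⟩ | ⟨h2, h3⟩
    · rw [← h2, ← h3]
    · rw [← h2, ← h3, add_comm]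
  have hker : ∀ f ∈ LinearMap.ker φ, f ⟨x, hx⟩ = 0 → f = 0 := by
    intro f hf hfx
    funext z
    rw [← hext f z]
    refine hH.eq_zero (fun e x y hl => ?_) hx ((hext f ⟨x, hx⟩).trans hfx) z.2
    rw [hφ f e x y hl, hf]
    rfl
  have hcard : Fintype.card E(H) + Module.finrank K (LinearMap.ker φ) ≤ Fintype.card V(H) := by
    rw [← Nat.card_coe_set_eq, ← Nat.card_coe_set_eq, Nat.card_eq_fintype_card,
      Nat.card_eq_fintype_card] at h
    rcases h with h | ⟨h, h0⟩
    · have : Module.finrank K (LinearMap.ker φ) ≤ Module.finrank K K :=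
        LinearMap.finrank_le_finrank_of_injective
          (f := (LinearMap.proj ⟨x, hx⟩ : (V(H) → K) →ₗ[K] K).domRestrict (LinearMap.ker φ)) (by
            rw [← LinearMap.ker_eq_bot, eq_bot_iff]
            rintro ⟨f, hf⟩ hf0
            exact Subtype.ext (hker f hf hf0))
      rw [Module.finrank_self] at this
      omega
    · have : LinearMap.ker φ = ⊥ := by
        rw [eq_bot_iff]
        intro f hf
        refine hker f hf ?_
        rw [← hext f ⟨x, hx⟩]
        refine h0 _ fun e x y hl => ?_
        rw [hφ f e x y hl, hf]
        rfl
      rw [this, finrank_bot]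
      exact h
  have hrange : LinearMap.range φ = ⊤ := by
    apply Submodule.eq_top_of_finrank_eq
    have h1 := φ.finrank_range_add_finrank_ker
    have h2 := Submodule.finrank_le (LinearMap.range φ)
    rw [Module.finrank_fintype_fun_eq_card] at *
    omega
  intro g
  obtain ⟨f, hf⟩ := LinearMap.range_eq_top.1 hrange fun e => g e
  exact ⟨ext f, fun e x y hl => by rw [hφ f e x y hl, hf]⟩

variable [CharZero K]

lemma isSolvable_of_tree_or_unicycle [Finite V(H)] [Finite E(H)]
    (h : H.IsTreeGraph ∨ H.IsOddUnicycle) : H.IsSolvable K := by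
  rcases h with ⟨hc, ha⟩ | ⟨hc, C, hC, hodd, huniq⟩
  · obtain ⟨x, hx⟩ := hc.1
    exact hc.isSolvable_of_ncard hx (Or.inl (ncard_edgeSet_lt_of_acyclic hc.1 ha))
  · obtain ⟨n, hn, hCn⟩ := id hodd
    obtain ⟨x, hx⟩ := hCn.nonempty
    refine hc.isSolvable_of_ncard (hC.vertexSet_mono hx) (Or.inr ⟨?_, fun f hf =>
      hodd.eq_zero (fun e x y hl => hf e x y (hl.mono hC)) hx⟩)
    -- Deleting one edge of the only cycle leaves an acyclic graph, whence `|E| ≤ |V|`.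
    obtain ⟨e, y, he, -⟩ := hCn.exists_edge hx ℚ
    have h1 : E(H.deleteEdges {e}) = E(H) \ {e} := rfl
    have h2 : V(H.deleteEdges {e}) = V(H) := rfl
    have : Finite V(H.deleteEdges {e}) := ‹Finite V(H)›
    have : Finite E(H.deleteEdges {e}) := Finite.Set.finite_diff E(H) {e}
    have h3 := ncard_edgeSet_lt_of_acyclic (H := H.deleteEdges {e}) hc.1 fun C' hC' hcyc => by
      have h4 := huniq C' (hC'.trans deleteEdges_le) hcyc
      subst h4
      have := hC'.edgeSet_mono he.edge_mem
      rw [h1] at this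
      exact this.2 rfl
    rw [h1, h2, Set.ncard_sdiff_singleton_of_mem (hC.edgeSet_mono he.edge_mem)] at h3
    omega

theorem isSolvable_of_components [Finite V(H)] [Finite E(H)]
    (h : ∀ C, H.IsComponent C → C.IsTreeGraph ∨ C.IsOddUnicycle) : H.IsSolvable K := by
  intro g
  have hsol : ∀ C, H.IsComponent C → C.IsSolvable K := fun C hC => by
    have : Finite V(C) := Finite.Set.subset _ hC.1.1.vertexSet_mono
    have : Finite E(C) := Finite.Set.subset _ hC.1.1.edgeSet_mono
    exact isSolvable_of_tree_or_unicycle (h C hC)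
  choose! f hf using fun C hC => hsol C hC g
  refine ⟨fun x => f (H.componentOf x) x, fun e x y hl => ?_⟩
  dsimp only
  rw [← componentOf_eq (.single hl.adj)]
  exact hf _ (isComponent_componentOf hl.left_mem) e x y ⟨hl, .refl, .single hl.adj⟩

end Graph

namespace Graph

variable {α β : Type*} {G H C D : Graph α β}

/-! ### Even circuits in graphs with two cycles -/

lemma exists_union {C₁ C₂ : Graph α β} (h₁ : C₁ ≤ H) (h₂ : C₂ ≤ H) :
    ∃ D ≤ H, V(D) = V(C₁) ∪ V(C₂) ∧ E(D) = E(C₁) ∪ E(C₂) ∧ C₁ ≤ D ∧ C₂ ≤ D := by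
  obtain ⟨D, hD, hV, hE⟩ := exists_le_of_sets (G := H) (X := V(C₁) ∪ V(C₂)) (F := E(C₁) ∪ E(C₂))
    (Set.union_subset h₁.vertexSet_mono h₂.vertexSet_mono) (by
      rintro e (he | he)
      · obtain ⟨x, y, h⟩ := exists_isLink_of_mem_edgeSet he
        exact ⟨x, Or.inl h.left_mem, y, Or.inl h.right_mem, h.mono h₁⟩
      · obtain ⟨x, y, h⟩ := exists_isLink_of_mem_edgeSet he
        exact ⟨x, Or.inr h.left_mem, y, Or.inr h.right_mem, h.mono h₂⟩)
  refine ⟨D, hD, hV, hE, (Compatible.of_le_le h₁ hD).le_iff.2 ?_,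
    (Compatible.of_le_le h₂ hD).le_iff.2 ?_⟩
  · rw [hV, hE]
    exact ⟨Set.subset_union_left, Set.subset_union_left⟩
  · rw [hV, hE]
    exact ⟨Set.subset_union_right, Set.subset_union_right⟩

/-- A vertex of `C` meets only two consecutive edges of `C`, and `C'`, unless a loop, has two
distinct edges at each of its vertices. Membership in `C'` thus passes from each edge of `C` to the
next. -/
lemma IsCycle.eq_of_edgeSet_subset {C' : Graph α β} (hC : C.IsCycle) (hC' : C'.IsCycle)
    (h : C ≤ H) (h' : C' ≤ H) (hE : E(C') ⊆ E(C)) : C' = C := by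
  obtain ⟨n, hC⟩ := hC
  obtain ⟨m, hC'⟩ := hC'
  obtain ⟨x, hx⟩ := hC'.nonempty
  have hle : C' ≤ C := (Compatible.of_le_le h' h).le_iff.2 ⟨fun y hy => by
    obtain ⟨v, e, rfl, -, hl, -⟩ := hC'.exists_periodic hy
    have h1 : C.IsLink (e 0) (v 0) (v (0 + 1)) :=
      (h.isLink_iff (hE (hl 0).edge_mem)).2 ((hl 0).mono h')
    exact h1.left_mem, hE⟩
  by_cases hm : m = 1
  · subst hm
    obtain ⟨v, e, h0, h1, hl, -⟩ := hC'.exists_periodic hx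
    have hl0 := hl 0
    rw [zero_add, h0, h1] at hl0
    obtain ⟨-, hV1, hE1⟩ := hC.eq_of_loop (hl0.mono hle)
    obtain ⟨-, hV2, hE2⟩ := hC'.eq_of_loop hl0
    exact (Compatible.of_le_le h' h).ext (hV2.trans hV1.symm) (hE2.trans hE1.symm)
  have hm' := hC'.1
  obtain ⟨hn, v, e, hv, he, hV, hE', hl⟩ := hC
  have hinc : ∀ i d y, C.IsLink d (v (i + 1)) y → d = e i ∨ d = e (i + 1) := by
    intro i d y hd
    obtain ⟨j, rfl⟩ : d ∈ Set.range e := hE' ▸ hd.edge_mem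
    rcases hd.left_eq_or_eq (hl j) with h1 | h1
    · exact Or.inr (congrArg e (hv h1).symm)
    · exact Or.inl (congrArg e (add_right_cancel (hv h1)).symm)
  have hstep : ∀ i, e i ∈ E(C') → e (i + 1) ∈ E(C') := by
    intro i hi
    have h1 : C'.IsLink (e i) (v i) (v (i + 1)) := (hle.isLink_iff hi).2 (hl i)
    obtain ⟨w, d, hw0, hwm, hwl, hs⟩ := hC'.exists_periodic h1.right_mem
    have h2 := hwl 0
    have h3 := hwl (m - 1)
    rw [show m - 1 + 1 = m by omega, hwm] at h3
    rw [hw0] at h2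
    have h4 : d 0 ≠ d (m - 1) := fun h => by
      have := (hs 0).2.1 0 (by omega) (m - 1) (by omega) (by simpa using h)
      omega
    rcases hinc i _ _ (h2.mono hle) with h5 | h5
    · rcases hinc i _ _ (h3.mono hle).symm with h6 | h6
      · exact absurd (h5.trans h6.symm) h4
      · exact h6 ▸ h3.edge_mem
    · exact h5 ▸ h2.edge_mem
  have hall : ∀ i, e i ∈ E(C') := by
    have : NeZero n := ⟨hn.ne'⟩
    obtain ⟨w, d, -, -, hwl, -⟩ := hC'.exists_periodic hx
    have h1 := ((hwl 0).mono hle).edge_mem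
    rw [hE'] at h1
    obtain ⟨i₀, hi₀⟩ := h1
    have h2 : ∀ k : ℕ, e (i₀ + k) ∈ E(C') := by
      intro k
      induction k with
      | zero => simpa [hi₀] using (hwl 0).edge_mem
      | succ k ih =>
        have := hstep _ ih
        rwa [add_assoc, ← Nat.cast_succ] at this
    intro i
    have := h2 (i - i₀).val
    rwa [ZMod.natCast_zmod_val, add_sub_cancel] at this
  refine hle.antisymm ((Compatible.of_le_le h h').le_iff.2 ⟨?_, ?_⟩)
  · rw [hV]
    rintro _ ⟨i, rfl⟩
    exact ((hle.isLink_iff (hall i)).2 (hl i)).left_mem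
  · rw [hE']
    rintro _ ⟨i, rfl⟩
    exact hall i

/-- A path in `C` and a path with the same ends that otherwise avoids `C` form a cycle. -/
lemma exists_cycle_of_ear (hC : C ≤ H) {q t : ℕ} (hq : 0 < q) {v w : ℕ → α} {e d : ℕ → β}
    (hvl : ∀ i < q, C.IsLink (e i) (v i) (v (i + 1)))
    (hv : ∀ i ≤ q, ∀ j ≤ q, v i = v j → i = j)
    (hwl : ∀ i < t, H.IsLink (d i) (w i) (w (i + 1)))
    (hw : ∀ i ≤ t, ∀ j ≤ t, w i = w j → i = j)
    (h0 : w 0 = v q) (ht : w t = v 0) (hwC : ∀ i < t, 0 < i → w i ∉ V(C))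
    (hdC : ∀ i < t, d i ∉ E(C)) : ∃ C' ≤ H, C'.IsCycleOfLength (q + t) := by
  have hcross : ∀ i < q, ∀ j < t, v i ≠ w j := by
    intro i hi j hj h
    rcases Nat.eq_zero_or_pos j with rfl | hj0
    · rw [h0] at h
      have := hv _ hi.le _ le_rfl h
      omega
    · exact hwC j hj hj0 (h ▸ (hvl i hi).left_mem)
  obtain ⟨C', hC', hcyc, -⟩ := exists_cycle_of_nat (G := H) (n := q + t) (by omega)
    (v := fun i => if i < q then v i else w (i - q))
    (e := fun i => if i < q then e i else d (i - q))
    (by simp [hq, ht])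
    (fun i hi => by
      by_cases h1 : i < q
      · have h2 := (hvl i h1).mono hC
        by_cases h3 : i + 1 < q
        · simpa [h1, h3] using h2
        · obtain rfl : i + 1 = q := by omega
          simpa [h0] using h2
      · have h2 := hwl (i - q) (by omega)
        rw [show i - q + 1 = i + 1 - q by omega] at h2
        simpa [h1, show ¬ (i + 1 < q) by omega] using h2)
    (fun i hi j hj h => by
      split_ifs at h with h1 h2 h2
      · exact hv i h1.le j h2.le h
      · exact absurd h (hcross i h1 _ (by omega))
      · exact absurd h.symm (hcross j h2 _ (by omega))
      · have := hw _ (by omega) _ (by omega) h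
        omega)
    (fun i hi j hj h => by
      split_ifs at h with h1 h2 h2
      · exact path_edge_injective hvl hv i h1 j h2 h
      · exact absurd (h ▸ (hvl i h1).edge_mem) (hdC _ (by omega))
      · exact absurd (h.symm ▸ (hvl j h2).edge_mem) (hdC _ (by omega))
      · have := path_edge_injective hwl hw _ (by omega) _ (by omega) h
        omega)
  exact ⟨C', hC', hcyc⟩

/-- Two distinct cycles, one of them odd, that share at least two vertices give rise to an even
cycle. -/
lemma exists_even_cycle_of_two_common {C' : Graph α β} {n : ℕ} (hC : C.IsCycleOfLength n)
    (hn : Odd n) (hC' : C'.IsCycle) (h : C ≤ H) (h' : C' ≤ H) (hne : C' ≠ C) {x y : α}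
    (hxy : x ≠ y) (hx : x ∈ V(C) ∩ V(C')) (hy : y ∈ V(C) ∩ V(C')) :
    ∃ D ≤ H, D.IsEvenCycle := by
  classical
  have hnE : ¬ E(C') ⊆ E(C) := fun hE => hne (IsCycle.eq_of_edgeSet_subset ⟨n, hC⟩ hC' h h' hE)
  obtain ⟨m, hC'⟩ := hC'
  have hend : ∀ {d a b}, C'.IsLink d a b → d ∈ E(C) → C.IsLink d a b := fun hl hd =>
    (h.isLink_iff hd).2 (hl.mono h')
  obtain ⟨w, d, hw0, -, hwl, hs⟩ := hC'.exists_periodic hx.2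
  -- Some edge of `C'` leaves `C` at `w j`; otherwise `C'` would never leave `C`.
  obtain ⟨j, hj, hdj⟩ : ∃ j, w j ∈ V(C) ∧ d j ∉ E(C) := by
    by_contra! hcon
    have hall : ∀ j, w j ∈ V(C) := by
      intro j
      induction j with
      | zero => exact hw0 ▸ hx.1
      | succ j ih => exact (hend (hwl j) (hcon j ih)).right_mem
    refine hnE fun e he => ?_
    obtain ⟨i, -, rfl⟩ := (hs 0).2.2.2 e he
    exact hcon _ (hall _)
  -- A second common vertex makes `C'` return to `C` before closing up, so the ear from `w j` to its
  -- first return has distinct ends.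
  obtain ⟨z, hz, hzj⟩ : ∃ z ∈ V(C) ∩ V(C'), z ≠ w j := by
    by_cases hxj : x = w j
    · exact ⟨y, hy, fun hyj => hxy (hxj.trans hyj.symm)⟩
    · exact ⟨x, hx, hxj⟩
  obtain ⟨k, hkm, hk⟩ := (hs j).2.2.1 z hz.2
  have hk0 : 0 < k := by
    rcases Nat.eq_zero_or_pos k with rfl | hk0
    · exact absurd hk.symm hzj
    · exact hk0
  have hex : ∃ t, 0 < t ∧ w (j + t) ∈ V(C) := ⟨k, hk0, hk ▸ hz.1⟩
  obtain ⟨ht0, htC⟩ := Nat.find_spec hex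
  have hmin := fun t => Nat.find_min hex (m := t)
  have htk : Nat.find hex ≤ k := Nat.find_min' hex ⟨hk0, hk ▸ hz.1⟩
  generalize Nat.find hex = t at *
  have hw : ∀ i ≤ t, ∀ i' ≤ t, w (j + i) = w (j + i') → i = i' := fun i hi i' hi' =>
    (hs j).1 i (by omega) i' (by omega)
  have hwC : ∀ i < t, 0 < i → w (j + i) ∉ V(C) := fun i hi hi0 hmem => hmin i hi ⟨hi0, hmem⟩
  have hdC : ∀ i < t, d (j + i) ∉ E(C) := by
    intro i hi hd
    rcases Nat.eq_zero_or_pos i with rfl | hi0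
    · exact hdj hd
    · exact hwC i hi hi0 (hend (hwl (j + i)) hd).left_mem
  have hwl' : ∀ i < t, H.IsLink (d (j + i)) (w (j + i)) (w (j + (i + 1))) := fun i _ =>
    (hwl (j + i)).mono h'
  obtain ⟨v, e, hv0, hvn, hvl, hsv⟩ := hC.exists_periodic htC
  obtain ⟨q, hqn, hq⟩ := (hsv 0).2.2.1 _ hj
  rw [zero_add] at hq
  have hq0 : 0 < q := by
    rcases Nat.eq_zero_or_pos q with rfl | hq0
    · rw [hv0] at hq
      have := hw t le_rfl 0 (by omega) (by simpa using hq)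
      omega
    · exact hq0
  -- The ends of the ear cut `C` into arcs of lengths `q` and `n - q`, of opposite parity because
  -- `n` is odd; one of them closes the ear to an even cycle.
  rcases Nat.even_or_odd (q + t) with hpar | hpar
  · obtain ⟨D, hD, hcyc⟩ := exists_cycle_of_ear h hq0 (v := v) (e := e)
      (fun i _ => hvl i) (fun i hi i' hi' hii => (hsv 0).1 i (by omega) i' (by omega)
        (by simpa using hii)) hwl' hw hq.symm hv0.symm hwC hdC
    exact ⟨D, hD, _, hpar, hcyc⟩
  · obtain ⟨D, hD, hcyc⟩ := exists_cycle_of_ear h (q := n - q) (by omega)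
      (v := fun i => v (n - i)) (e := fun i => e (n - (i + 1)))
      (fun i hi => by
        have := (hvl (n - 1 - i)).symm
        rwa [show n - 1 - i + 1 = n - i by omega, show n - 1 - i = n - (i + 1) by omega] at this)
      (fun i hi i' hi' hii => by
        have := (hsv 1).1 (n - i - 1) (by omega) (n - i' - 1) (by omega)
          (by rwa [show 1 + (n - i - 1) = n - i by omega,
            show 1 + (n - i' - 1) = n - i' by omega])
        omega) hwl' hw (by simp only [show n - (n - q) = q by omega]; exact hq.symm)
      (by simp only [Nat.sub_zero, hvn]) hwC hdC
    refine ⟨D, hD, _, ?_, hcyc⟩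
    rw [Nat.even_iff]
    rw [Nat.odd_iff] at hpar hn
    omega

/-- Disjoint cycles give a handcuff through a shortest connecting path, one common vertex a figure
eight, and two or more an even cycle. -/
lemma exists_evenCircuit_of_two_cycles {C' : Graph α β} (hH : H.IsConnected) (hC : C.IsOddCycle)
    (hC' : C'.IsOddCycle) (h : C ≤ H) (h' : C' ≤ H) (hne : C' ≠ C) :
    ∃ D ≤ H, D.IsEvenCircuit := by
  obtain ⟨n, hn, hCn⟩ := id hC
  obtain ⟨m, hm, hCm⟩ := id hC'
  rcases Set.eq_empty_or_nonempty (V(C) ∩ V(C')) with hI | ⟨x, hx⟩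
  · obtain ⟨a, ha⟩ := hCn.nonempty
    obtain ⟨b, hb⟩ := hCm.nonempty
    obtain ⟨e₀, -⟩ := (hCn.exists_edge ha ℚ)
    have : Nonempty β := ⟨e₀⟩
    obtain ⟨k, v, e, h0, hk, hl, hv, hA, hB⟩ := exists_shortest_path ha hb
      (hH.2 a (h.vertexSet_mono ha) b (h'.vertexSet_mono hb))
    have hmem : ∀ i ≤ k, v i ∈ V(H) := by
      intro i hi
      rcases hi.lt_or_eq with hi | rfl
      · exact (hl i hi).left_mem
      · exact h'.vertexSet_mono hk
    obtain ⟨P, hP, hVP, hEP⟩ := exists_le_of_sets (G := H) (X := v '' Set.Iic k)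
      (F := e '' Set.Iio k) (by rintro _ ⟨i, hi, rfl⟩; exact hmem i hi)
      (by
        rintro _ ⟨i, hi, rfl⟩
        exact ⟨_, ⟨i, Set.mem_Iic.2 (le_of_lt hi), rfl⟩, _, ⟨i + 1, hi, rfl⟩, hl i hi⟩)
    obtain ⟨D₁, hD₁, hV₁, hE₁, hle₁, hle₂⟩ := exists_union h h'
    obtain ⟨D, hD, hV, hE, hle₃, hle₄⟩ := exists_union hD₁ hP
    refine ⟨D, hD, Or.inr (Or.inr ⟨C, hle₁.trans hle₃, C', hle₂.trans hle₃, P, hle₄, v 0, v k,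
      hC, hC', ⟨k, fun i => v i, fun i => e i, ?_, ?_, ?_, rfl, rfl, ?_⟩, ?_, ?_, ?_, ?_, ?_⟩)⟩
    · exact fun i j hij => Fin.ext (hv i (Nat.le_of_lt_succ i.2) j (Nat.le_of_lt_succ j.2) hij)
    · rw [hVP]
      ext z
      constructor
      · rintro ⟨i, hi, rfl⟩
        exact ⟨⟨i, Nat.lt_succ_of_le hi⟩, rfl⟩
      · rintro ⟨i, rfl⟩
        exact ⟨i, Nat.le_of_lt_succ i.2, rfl⟩
    · rw [hEP]
      ext z
      constructor
      · rintro ⟨i, hi, rfl⟩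
        exact ⟨⟨i, hi⟩, rfl⟩
      · rintro ⟨i, rfl⟩
        exact ⟨i, i.2, rfl⟩
    · intro i
      exact (hP.isLink_iff (by rw [hEP]; exact ⟨i, i.2, rfl⟩)).2 (hl i i.2)
    · exact Set.disjoint_iff_inter_eq_empty.2 hI
    · rw [hVP]
      ext z
      constructor
      · rintro ⟨⟨i, hi, rfl⟩, hz⟩
        rw [hA i hi hz]
        rfl
      · rintro rfl
        exact ⟨⟨0, Nat.zero_le k, rfl⟩, h0⟩
    · rw [hVP]
      ext z
      constructor
      · rintro ⟨⟨i, hi, rfl⟩, hz⟩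
        rw [hB i hi hz]
        rfl
      · rintro rfl
        exact ⟨⟨k, Set.mem_Iic.2 le_rfl, rfl⟩, hk⟩
    · rw [hV, hV₁]
    · rw [hE, hE₁]
  · by_cases hy : ∃ y ∈ V(C) ∩ V(C'), x ≠ y
    · obtain ⟨y, hy, hxy⟩ := hy
      obtain ⟨D, hD, hcyc⟩ := exists_even_cycle_of_two_common hCn hn ⟨m, hCm⟩ h h' hne hxy hx hy
      exact ⟨D, hD, Or.inl hcyc⟩
    · push Not at hy
      obtain ⟨D, hD, hV, hE, hle₁, hle₂⟩ := exists_union h h'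
      refine ⟨D, hD, Or.inr (Or.inl ⟨C, hle₁, C', hle₂, hC, hC', hne.symm, ⟨x, ?_⟩, hV, hE⟩)⟩
      ext z
      exact ⟨fun hz => (hy z hz).symm, by rintro rfl; exact hx⟩

theorem tree_or_unicycle_of_no_evenCircuit (hH : H.IsConnected) (h : ∀ D ≤ H, ¬ D.IsEvenCircuit) :
    H.IsTreeGraph ∨ H.IsOddUnicycle := by
  by_cases ha : ∃ C ≤ H, C.IsCycle
  · right
    have hodd : ∀ C ≤ H, C.IsCycle → C.IsOddCycle := by
      rintro C hC ⟨n, hn⟩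
      rcases Nat.even_or_odd n with hp | hp
      · exact absurd (Or.inl ⟨n, hp, hn⟩) (h C hC)
      · exact ⟨n, hp, hn⟩
    obtain ⟨C, hC, hcyc⟩ := ha
    refine ⟨hH, C, hC, hodd C hC hcyc, fun C' hC' hcyc' => ?_⟩
    by_contra hne
    obtain ⟨D, hD, hD'⟩ := exists_evenCircuit_of_two_cycles hH (hodd C hC hcyc)
      (hodd C' hC' hcyc') hC hC' hne
    exact h D hD hD'
  · push Not at ha
    exact Or.inl ⟨hH, ha⟩

/-- The components of a finite graph are trees and odd unicycles if and only if its edge equations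
are solvable. -/
theorem forall_components_iff_isSolvable [Finite V(H)] [Finite E(H)] (K : Type*) [Field K]
    [CharZero K] :
    (∀ C, H.IsComponent C → C.IsTreeGraph ∨ C.IsOddUnicycle) ↔ H.IsSolvable K :=
  ⟨isSolvable_of_components, fun hS _ hC => tree_or_unicycle_of_no_evenCircuit hC.1.2 fun _ hD hD' =>
    hD'.not_isSolvable K (hS.mono (hD.trans hC.1.1))⟩

theorem exists_evenCircuit_of_not_isSolvable [Finite V(H)] [Finite E(H)] {K : Type*} [Field K]
    [CharZero K] (h : ¬ H.IsSolvable K) : ∃ D ≤ H, D.IsEvenCircuit := by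
  by_contra! hcon
  exact h (isSolvable_of_components fun C hC =>
    tree_or_unicycle_of_no_evenCircuit hC.1.2 fun D hD => hcon D (hD.trans hC.1.1))

end Graph

/-! ### Independence and activity of incidence columns in terms of the graph. -/

namespace Graph

variable {α β : Type*} {G : Graph α β} {K : Type*} [Field K]

open Classical in
/-- The column of the undirected incidence matrix at an edge. -/
noncomputable def incidenceColumn (K : Type*) [Field K] (G : Graph α β) (e : E(G)) (v : V(G)) : K :=
  if G.Inc e.1 v.1 then 1 else 0

/-- At a loop the product is `f x` and the sum is `2 * f x`, so only their vanishing can be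
compared. -/
lemma incidenceColumn_dotProduct_eq_zero [CharZero K] [Fintype V(G)] (e : E(G)) (f : α → K)
    {x y : α} (h : G.IsLink e x y) :
    incidenceColumn K G e ⬝ᵥ (fun v => f v) = 0 ↔ f x + f y = 0 := by
  classical
  have h1 : incidenceColumn K G e ⬝ᵥ (fun v => f v) =
      ∑ v ∈ ({⟨x, h.left_mem⟩, ⟨y, h.right_mem⟩} : Finset V(G)), f v := by
    rw [dotProduct, ← Finset.sum_subset (Finset.subset_univ _)]
    · refine Finset.sum_congr rfl fun v hv => ?_
      rw [incidenceColumn, if_pos, one_mul]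
      rw [Finset.mem_insert, Finset.mem_singleton] at hv
      rcases hv with rfl | rfl
      exacts [h.inc_left, h.inc_right]
    · intro v _ hv
      rw [incidenceColumn, if_neg, zero_mul]
      intro hinc
      rw [Finset.mem_insert, Finset.mem_singleton] at hv
      exact hv ((hinc.eq_or_eq_of_isLink h).imp Subtype.ext Subtype.ext)
  rw [h1]
  by_cases hxy : x = y
  · subst hxy
    simp
  · rw [Finset.sum_pair fun h => hxy (congrArg Subtype.val h)]

variable [Fintype V(G)] [Fintype E(G)] [LinearOrder E(G)] [CharZero K]

lemma mem_nonactive_iff {F : Finset E(G)} {e : E(G)} :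
    e ∈ PowerIdeal.nonactive K (incidenceColumn K G) Finset.univ F ↔
      ∃ f : α → K, (∀ x y, G.IsLink e x y → f x + f y ≠ 0) ∧
        ∀ d ∈ F, e < d → ∀ x y, G.IsLink d x y → f x + f y = 0 := by
  classical
  rw [PowerIdeal.nonactive, Finset.mem_filter, and_iff_right (Finset.mem_univ _),
    PowerIdeal.notMem_span_iff_exists_dotProduct]
  constructor
  · rintro ⟨f, h1, h2⟩
    let f' : α → K := fun z => if hz : z ∈ V(G) then f ⟨z, hz⟩ else 0
    have hf : f = fun v : V(G) => f' v := funext fun v => by simp [f']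
    refine ⟨f', fun x y hl h0 => h1 ?_, fun d hd hed x y hl => ?_⟩
    · rw [hf]
      exact (incidenceColumn_dotProduct_eq_zero e f' hl).2 h0
    · refine (incidenceColumn_dotProduct_eq_zero d f' hl).1 ?_
      rw [← hf]
      exact h2 _ ⟨d, ⟨hd, hed⟩, rfl⟩
  · rintro ⟨f, h1, h2⟩
    refine ⟨fun v => f v, ?_, ?_⟩
    · obtain ⟨x, y, hl⟩ := exists_isLink_of_mem_edgeSet e.2
      exact fun h0 => h1 x y hl ((incidenceColumn_dotProduct_eq_zero e f hl).1 h0)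
    · rintro _ ⟨d, ⟨hd, hed⟩, rfl⟩
      obtain ⟨x, y, hl⟩ := exists_isLink_of_mem_edgeSet d.2
      exact (incidenceColumn_dotProduct_eq_zero d f hl).2 (h2 d hd hed x y hl)

omit [Fintype V(G)] [Fintype E(G)] [LinearOrder E(G)] [CharZero K] in
/-- Adding a multiple of a function that vanishes on all edges of `F` but not on `e` solves the
equation at `e`. -/
lemma isSolvable_restrict_insert {F : Set β} {e : β} (hF : (G.restrict F).IsSolvable K) {f : α → K}
    (hfe : ∀ x y, G.IsLink e x y → f x + f y ≠ 0)
    (hf : ∀ d ∈ F, ∀ x y, G.IsLink d x y → f x + f y = 0) :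
    (G.restrict (insert e F)).IsSolvable K := by
  intro g
  by_cases he : e ∈ E(G)
  · obtain ⟨f₁, hf₁⟩ := hF g
    obtain ⟨a, b, hab⟩ := exists_isLink_of_mem_edgeSet he
    have hne := hfe a b hab
    refine ⟨fun z => f₁ z + (g e - (f₁ a + f₁ b)) / (f a + f b) * f z, ?_⟩
    rintro d x y ⟨rfl | hd, hl⟩
    · have h1 : f x + f y = f a + f b ∧ f₁ x + f₁ y = f₁ a + f₁ b := by
        rcases hl.eq_and_eq_or_eq_and_eq hab with ⟨rfl, rfl⟩ | ⟨rfl, rfl⟩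
        exacts [⟨rfl, rfl⟩, ⟨add_comm _ _, add_comm _ _⟩]
      have h2 : (g d - (f₁ a + f₁ b)) / (f a + f b) * (f a + f b) = g d - (f₁ a + f₁ b) :=
        div_mul_cancel₀ _ hne
      linear_combination h1.2 + h2 + (g d - (f₁ a + f₁ b)) / (f a + f b) * h1.1
    · have h1 := hf d hd x y hl
      have h2 := hf₁ d x y ⟨hd, hl⟩
      linear_combination h2 + (g e - (f₁ a + f₁ b)) / (f a + f b) * h1
  · obtain ⟨f₁, hf₁⟩ := hF g
    refine ⟨f₁, ?_⟩
    rintro d x y ⟨rfl | hd, hl⟩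
    · exact absurd hl.edge_mem he
    · exact hf₁ d x y ⟨hd, hl⟩

/-- Solvability is built by adding edges in decreasing order: nonactivity of the new smallest edge
supplies a weighting that vanishes on all the others but not on it. Conversely, solving for the
indicator of `e` gives such a weighting. -/
lemma subset_nonactive_iff {F : Finset E(G)} :
    F ⊆ PowerIdeal.nonactive K (incidenceColumn K G) Finset.univ F ↔
      (G.restrict (Subtype.val '' (F : Set E(G)))).IsSolvable K := by
  classical
  constructor
  · induction F using Finset.induction_on_min with
    | empty =>
      intro _ g
      refine ⟨0, ?_⟩
      rintro e x y ⟨⟨d, hd, -⟩, -⟩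
      simp at hd
    | insert e F hmin ih =>
      intro h
      rw [Finset.coe_insert, Set.image_insert_eq]
      obtain ⟨f, hf1, hf2⟩ := mem_nonactive_iff.1 (h (Finset.mem_insert_self e F))
      refine isSolvable_restrict_insert (ih fun d hd => ?_) hf1 ?_
      · obtain ⟨f, hf1, hf2⟩ := mem_nonactive_iff.1 (h (Finset.mem_insert_of_mem hd))
        exact mem_nonactive_iff.2 ⟨f, hf1, fun d' hd' => hf2 d' (Finset.mem_insert_of_mem hd')⟩
      · rintro _ ⟨d, hd, rfl⟩ x y hl
        exact hf2 d (Finset.mem_insert_of_mem hd) (hmin d hd) x y hl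
  · intro h e he
    obtain ⟨f, hf⟩ := h fun d => if d = e then 1 else 0
    refine mem_nonactive_iff.2 ⟨f, fun x y hl => ?_, fun d hd hed x y hl => ?_⟩
    · rw [hf e x y ⟨⟨e, he, rfl⟩, hl⟩, if_pos rfl]
      exact one_ne_zero
    · rw [hf d x y ⟨⟨d, hd, rfl⟩, hl⟩, if_neg]
      exact fun h => hed.ne' (Subtype.ext h)

/-- If `e` is smallest in an even circuit `D`, the rest of `D` lies in `F` above `e`; nonactivity of
`e` would make `D` solvable. Conversely, if `e` is active, then `e` with the larger edges of `F` is
not solvable and contains an even circuit. That circuit must use `e`, since `F` is solvable. -/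
lemma isEvenlyActive_iff {F : Finset E(G)}
    (hF : (G.restrict (Subtype.val '' (F : Set E(G)))).IsSolvable K) {e : E(G)} :
    G.IsEvenlyActive (Subtype.val '' (F : Set E(G))) e ↔
      e ∉ PowerIdeal.nonactive K (incidenceColumn K G) Finset.univ F := by
  classical
  constructor
  · rintro ⟨D, hD, hcirc, heD, hmin⟩ hmem
    obtain ⟨f, hf1, hf2⟩ := mem_nonactive_iff.1 hmem
    let F' : Set β := E(D) \ {e.1}
    have hF' : ∀ d ∈ F', ∃ d' ∈ F, d'.1 = d ∧ e < d' := by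
      rintro d ⟨hd, hde⟩
      have hd' := (hD.edgeSet_mono hd).2
      rcases hd' with ⟨d', hd', rfl⟩ | hd'
      · exact ⟨d', hd', rfl, lt_of_le_of_ne (hmin d' hd) fun h => hde (h ▸ rfl)⟩
      · exact absurd hd' hde
    have h1 : (G.restrict F').IsSolvable K := hF.mono <| restrict_mono_right G fun d hd => by
      obtain ⟨d', hd', rfl, -⟩ := hF' d hd
      exact ⟨d', hd', rfl⟩
    have h2 := isSolvable_restrict_insert h1 hf1 fun d hd x y hl => by
      obtain ⟨d', hd', rfl, hlt⟩ := hF' d hd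
      exact hf2 d' hd' hlt x y hl
    refine hcirc.not_isSolvable K (h2.mono ?_)
    rw [show insert e.1 F' = E(D) by simp [F', Set.insert_eq_of_mem heD]]
    have hDG := hD.trans restrict_le
    exact ⟨hDG.vertexSet_mono, fun d x y hl => ⟨hl.edge_mem, hl.mono hDG⟩⟩
  · intro hmem
    have hsub : ∀ {d}, d ∈ (Subtype.val '' {d | d ∈ F ∧ e < d} : Set β) →
        d ∈ (Subtype.val '' (F : Set E(G)) : Set β) := by
      rintro _ ⟨d, hd, rfl⟩
      exact ⟨d, hd.1, rfl⟩
    have hns : ¬ (G.restrict (insert e.1 (Subtype.val '' {d | d ∈ F ∧ e < d}))).IsSolvable K := by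
      intro hS
      obtain ⟨f, hf⟩ := hS fun d => if d = e then 1 else 0
      refine hmem (mem_nonactive_iff.2 ⟨f, fun x y hl => ?_, fun d hd hed x y hl => ?_⟩)
      · rw [hf e x y ⟨Or.inl rfl, hl⟩, if_pos rfl]
        exact one_ne_zero
      · rw [hf d x y ⟨Or.inr ⟨d, ⟨hd, hed⟩, rfl⟩, hl⟩, if_neg]
        exact fun h => hed.ne' (Subtype.ext h)
    have : Finite V(G.restrict (insert e.1 (Subtype.val '' {d | d ∈ F ∧ e < d}))) :=
      inferInstanceAs (Finite V(G))
    have : Finite E(G.restrict (insert e.1 (Subtype.val '' {d | d ∈ F ∧ e < d}))) :=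
      Finite.Set.subset E(G) Set.inter_subset_left
    obtain ⟨D, hD, hcirc⟩ := exists_evenCircuit_of_not_isSolvable hns
    refine ⟨D, hD.trans (restrict_mono_right G ?_), hcirc, ?_, ?_⟩
    · rintro d (rfl | hd)
      exacts [Or.inr rfl, Or.inl (hsub hd)]
    · by_contra heD
      refine hcirc.not_isSolvable K (hF.mono ⟨hD.vertexSet_mono, fun d x y hl => ?_⟩)
      obtain ⟨hd, hl'⟩ := hl.mono hD
      refine ⟨?_, hl'⟩
      rcases hd with rfl | hd
      · exact absurd hl.edge_mem heD
      · exact hsub hd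
    · intro d hd
      rcases (hD.edgeSet_mono hd).2 with h | ⟨d', hd', h⟩
      · exact (Subtype.ext h).ge
      · rw [← Subtype.ext h]
        exact hd'.2.le

lemma image_mem_oddCirclePseudoforests_iff (K : Type*) [Field K] [CharZero K] {F : Finset E(G)} :
    Subtype.val '' (F : Set E(G)) ∈ G.oddCirclePseudoforests ↔
      F ⊆ PowerIdeal.nonactive K (incidenceColumn K G) Finset.univ F := by
  have : Finite V(G.restrict (Subtype.val '' (F : Set E(G)))) := inferInstanceAs (Finite V(G))
  have : Finite E(G.restrict (Subtype.val '' (F : Set E(G)))) :=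
    Finite.Set.subset E(G) Set.inter_subset_left
  rw [subset_nonactive_iff, ← forall_components_iff_isSolvable K]
  refine and_iff_right ?_
  rintro _ ⟨e, -, rfl⟩
  exact e.2

/-- The evenly active edges form the complement of the nonactive ones, which include `F`. -/
lemma evenActivity_eq {F : Finset E(G)}
    (hF : F ⊆ PowerIdeal.nonactive K (incidenceColumn K G) Finset.univ F) :
    (G.evenActivity (Subtype.val '' (F : Set E(G))) : ℤ) =
      ((E(G) \ Subtype.val '' (F : Set E(G))).ncard : ℤ) -
        (PowerIdeal.nonactive K (incidenceColumn K G) Finset.univ F \ F).card := by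
  have h1 : {e : E(G) | G.IsEvenlyActive (Subtype.val '' (F : Set E(G))) e} =
      ((PowerIdeal.nonactive K (incidenceColumn K G) Finset.univ F)ᶜ : Finset E(G)) := by
    ext e
    rw [Set.mem_ofPred_eq, isEvenlyActive_iff (subset_nonactive_iff.1 hF), Finset.mem_coe,
      Finset.mem_compl]
  have h2 : E(G) \ Subtype.val '' (F : Set E(G)) = Subtype.val '' ((Fᶜ : Finset E(G)) : Set E(G)) := by
    ext d
    simp only [Set.mem_sdiff, Set.mem_image, Finset.mem_coe, Finset.mem_compl]
    constructor
    · rintro ⟨hd, h⟩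
      exact ⟨⟨d, hd⟩, fun hd' => h ⟨_, hd', rfl⟩, rfl⟩
    · rintro ⟨d', hd', rfl⟩
      exact ⟨d'.2, fun ⟨d'', h, h'⟩ => hd' (Subtype.ext h' ▸ h)⟩
  rw [evenActivity, h1, Set.ncard_coe_finset, h2,
    Subtype.val_injective.injOn.ncard_image, Set.ncard_coe_finset, Finset.card_compl,
    Finset.card_compl, Finset.card_sdiff_of_subset hF]
  have h3 := Finset.card_le_card hF
  have h4 := Finset.card_le_univ
    (PowerIdeal.nonactive K (incidenceColumn K G) Finset.univ F)
  have h5 : Fintype.card {x // x ∈ E(G)} = Fintype.card E(G) := rfl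
  omega

omit [Fintype V(G)] [CharZero K] in
lemma ncard_setOf_eq_card_indepSets (κ : Set ℕ) (s : Set (Set β)) (hs : ∀ F ∈ s, F ⊆ E(G))
    (h : ∀ F : Finset E(G), Subtype.val '' (F : Set E(G)) ∈ s ↔
      F ∈ PowerIdeal.indepSets K (incidenceColumn K G) Finset.univ κ) :
    s.ncard = (PowerIdeal.indepSets K (incidenceColumn K G) Finset.univ κ).card := by
  classical
  have h1 : s = (fun F : Finset E(G) => Subtype.val '' (F : Set E(G))) ''
      (PowerIdeal.indepSets K (incidenceColumn K G) Finset.univ κ : Set (Finset E(G))) := by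
    ext F
    constructor
    · intro hF
      have h2 : Subtype.val '' ((Finset.univ.filter fun e : E(G) => e.1 ∈ F : Finset E(G)) :
          Set E(G)) = F := by
        ext d
        simp only [Finset.coe_filter, Set.mem_image, Set.mem_ofPred_eq, Finset.mem_univ, true_and]
        exact ⟨by rintro ⟨e, he, rfl⟩; exact he, fun hd => ⟨⟨d, hs F hF hd⟩, hd, rfl⟩⟩
      refine ⟨_, (h _).1 ?_, h2⟩
      rwa [h2]
    · rintro ⟨F, hF, rfl⟩
      exact (h F).2 hF
  rw [h1, Function.Injective.injOn (fun F F' hFF => Finset.coe_injective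
    (Subtype.val_injective.image_injective hFF)) |>.ncard_image, Set.ncard_coe_finset]

end Graph

/-! ### Translation of the matrix formula into graph terms. -/

theorem mainTheorem1 {K : Type*} [Field K] [CharZero K] {α β : Type*} (G : Graph α β)
    [Finite V(G)] [Fintype E(G)] [LinearOrder E(G)] :
    Module.Finite K (circulationAlgebra (G.undirectedIncidenceMatrix K)) ∧
    Module.finrank K (circulationAlgebra (G.undirectedIncidenceMatrix K)) =
      G.oddCirclePseudoforests.ncard ∧
    ∀ k : ℕ,
      Module.finrank K (circulationAlgebraPart (G.undirectedIncidenceMatrix K) k) =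
        {F ∈ G.oddCirclePseudoforests |
          (G.evenActivity F : ℤ) = ((E(G) \ F).ncard : ℤ) - (k : ℤ)}.ncard := by
  have := Fintype.ofFinite V(G)
  have hA : G.undirectedIncidenceMatrix K =
      Matrix.of fun v e => Graph.incidenceColumn K G e v := rfl
  obtain ⟨h1, h2, h3⟩ := PowerIdeal.finrank_circulationAlgebra (Graph.incidenceColumn K G)
  rw [hA]
  refine ⟨h1, h2.trans ?_, fun k => (h3 k).trans ?_⟩
  · refine (Graph.ncard_setOf_eq_card_indepSets _ _ (fun F hF => hF.1) fun F => ?_).symm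
    rw [Graph.image_mem_oddCirclePseudoforests_iff K]
    simp [PowerIdeal.mem_indepSets]
  · refine (Graph.ncard_setOf_eq_card_indepSets _ _ (fun F hF => hF.1.1) fun F => ?_).symm
    rw [Set.mem_sep_iff, Graph.image_mem_oddCirclePseudoforests_iff K,
      PowerIdeal.mem_indepSets, and_iff_right (Finset.subset_univ F)]
    refine and_congr_right fun hF => ?_
    rw [Graph.evenActivity_eq hF, Set.mem_singleton_iff]
    omega
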